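/- Let $n$ be a dimension and let $\Phi\in C^2(\mathbb R^n,\mathbb R)$ satisfy $\int_{\mathbb R^n}e^{-\Phi(x)}\,dx=1$. Put $d\mu=e^{-\Phi}\,dx$, let $L^2(\mu)=L^2(\mathbb R^n,\mu,\mathbb C)$ with scalar product $(u\,|\,w)_\mu=\int u\,\overline w\,d\mu$, and let $$H^1(\mu)=\{u\in L^2(\mu)\mid \partial_ju\in L^2(\mu),\ j=1,\dots,n\}$$ (derivatives in the sense of distributions on $\mathbb R^n$), with scalar product $(u\,|\,w)_\mu+a_0(u,w)$, where $a_0(u,w)=\sum_{j=1}^n(\partial_ju\,|\,\partial_jw)_\mu$. Let $A_0$ be the unbounded operator in $L^2(\mu)$ with domain $$D(A_0)=\{u\in H^1(\mu)\mid \exists f\in L^2(\mu)\ \forall w\in H^1(\mu):\ a_0(u,w)=(f\,|\,w)_\mu\},\qquad A_0u=f$$ (a realisation of $-\Delta+\Phi'\cdot\nabla$, where $\Phi'$ denotes the gradient of $\Phi$). Let $\sigma_{\rm ess}(A_0)=\sigma(A_0)\setminus\sigma_{\rm disc}(A_0)$, where $\sigma_{\rm disc}(A_0)$ is the set of isolated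 points of the spectrum $\sigma(A_0)$ that are eigenvalues of finite multiplicity. If there is $\theta\in(0,1)$ such that $$\theta\,|\Phi'(x)|^2-\Delta\Phi(x)\to\infty\quad\text{as } |x|\to\infty,$$ then the embedding $H^1(\mu)\hookrightarrow L^2(\mu)$ is compact. Consequently $\sigma_{\rm ess}(A_0)=\emptyset$. -/

import Mathlib

open MeasureTheory Filter Topology
open scoped ContDiff ENNReal

noncomputable section

namespace WittenLaplacian

/-- Euclidean space `ℝⁿ`. -/
abbrev E (n : ℕ) : Type := EuclideanSpace ℝ (Fin n)

/-- A potential: `Φ ∈ C²(ℝⁿ, ℝ)` with `∫ e^{-Φ} dx = 1`.  (The Bochner integral of a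
non-integrable function is `0`, so the second field contains integrability.) -/
structure Potential (n : ℕ) where
  /-- The function `Φ`. -/
  toFun : E n → ℝ
  contDiff : ContDiff ℝ 2 toFun
  integral_exp_neg : ∫ x, Real.exp (-toFun x) = 1

instance (n : ℕ) : CoeFun (Potential n) (fun _ => E n → ℝ) := ⟨Potential.toFun⟩

variable {n : ℕ}

/-- The probability measure `dμ = e^{-Φ} dx` on `ℝⁿ`. -/
def Potential.μ (Φ : Potential n) : Measure (E n) :=
  volume.withDensity (fun x => ENNReal.ofReal (Real.exp (-Φ x)))

/-- `L²(μ) = L²(ℝⁿ, μ, ℂ)`. -/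
abbrev L2 (Φ : Potential n) : Type := Lp ℂ 2 Φ.μ

/-- `L²(μ, ∧¹ℂⁿ)`: 1-forms, identified with `ℂⁿ`-valued functions. -/
abbrev L2Form (Φ : Potential n) : Type := Lp (EuclideanSpace ℂ (Fin n)) 2 Φ.μ

/-- `g` is the gradient of `u` in the sense of distributions on `ℝⁿ` (with respect to Lebesgue
measure): `∫ ∂ⱼφ u dx = - ∫ φ gⱼ dx` for all `j` and all test functions `φ`. It is only used for
locally integrable `u` and `g`, see `locallyIntegrable_coeFn` below; by linearity it suffices to
test with real valued `φ`. -/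
def IsWeakGradient (u : E n → ℂ) (g : E n → EuclideanSpace ℂ (Fin n)) : Prop :=
  ∀ (j : Fin n) (φ : E n → ℝ), ContDiff ℝ ∞ φ → HasCompactSupport φ →
    ∫ x, (fderiv ℝ φ x (EuclideanSpace.single j 1)) • u x = - ∫ x, φ x • g x j

/-! ### Comparison of `μ` with Lebesgue measure -/

theorem Potential.continuous (Φ : Potential n) : Continuous Φ := Φ.contDiff.continuous

theorem Potential.measurable_density (Φ : Potential n) :
    Measurable (fun x => ENNReal.ofReal (Real.exp (-Φ x))) :=
  (ENNReal.continuous_ofReal.comp (Real.continuous_exp.comp Φ.continuous.neg)).measurable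

theorem Potential.volume_ac (Φ : Potential n) : (volume : Measure (E n)) ≪ Φ.μ :=
  withDensity_absolutelyContinuous' Φ.measurable_density.aemeasurable
    (Eventually.of_forall fun x => by simp [Real.exp_pos])

instance (Φ : Potential n) : IsProbabilityMeasure Φ.μ where
  measure_univ := by
    have hint : Integrable (fun x => Real.exp (-Φ x)) := by
      by_contra h
      have := Φ.integral_exp_neg
      rw [integral_undef h] at this
      exact zero_ne_one this
    rw [Potential.μ, withDensity_apply _ MeasurableSet.univ, setLIntegral_univ,
      ← ofReal_integral_eq_lintegral_ofReal hint
        (Eventually.of_forall fun x => (Real.exp_pos _).le), Φ.integral_exp_neg]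
    simp

/-- Elements of `L²(μ)` are locally integrable for Lebesgue measure. -/
theorem locallyIntegrable_coeFn {F : Type*} [NormedAddCommGroup F] [NormedSpace ℝ F]
    (Φ : Potential n) (u : Lp F 2 Φ.μ) : LocallyIntegrable (u : E n → F) := by
  have hu : Integrable (u : E n → F) Φ.μ := (Lp.memLp u).integrable (by norm_num)
  have hu' : Integrable (fun x => (Real.exp (-Φ x)) • (u : E n → F) x) := by
    refine ((integrable_withDensity_iff_integrable_smul' Φ.measurable_density
      (Eventually.of_forall fun x => ENNReal.ofReal_lt_top)).1 hu).congr
      (Eventually.of_forall fun x => ?_)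
    simp [ENNReal.toReal_ofReal (Real.exp_pos _).le]
  have hc : Continuous (fun x => Real.exp (Φ x)) := Real.continuous_exp.comp Φ.continuous
  have h2 := (hu'.locallyIntegrable.locallyIntegrableOn Set.univ).continuousOn_smul
    isOpen_univ.isLocallyClosed hc.continuousOn
  rw [locallyIntegrableOn_univ] at h2
  have he : (fun x => Real.exp (Φ x) • Real.exp (-Φ x) • (u : E n → F) x) = (u : E n → F) := by
    funext x
    simp [smul_smul, ← Real.exp_add]
  exact he ▸ h2

theorem integrable_test_smul {F : Type*} [NormedAddCommGroup F] [NormedSpace ℝ F]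
    (Φ : Potential n) (u : Lp F 2 Φ.μ) {φ : E n → ℝ} (hφ : Continuous φ)
    (hc : HasCompactSupport φ) : Integrable (fun x => φ x • (u : E n → F) x) :=
  (locallyIntegrable_coeFn Φ u).integrable_smul_left_of_hasCompactSupport hφ hc

theorem integrable_test_smul_apply (Φ : Potential n) (g : L2Form Φ) (j : Fin n) {φ : E n → ℝ}
    (hφ : Continuous φ) (hc : HasCompactSupport φ) :
    Integrable (fun x => φ x • (g : E n → EuclideanSpace ℂ (Fin n)) x j) := by
  have := ((EuclideanSpace.proj (𝕜 := ℂ) j).restrictScalars ℝ).integrable_comp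
    (integrable_test_smul Φ g hφ hc)
  simpa using this

theorem continuous_fderiv_test {F : Type*} [NormedAddCommGroup F] [NormedSpace ℝ F]
    {φ : E n → F} (hφ : ContDiff ℝ ∞ φ) (v : E n) : Continuous (fun x => fderiv ℝ φ x v) :=
  (hφ.continuous_fderiv (by simp)).clm_apply continuous_const

theorem hasCompactSupport_fderiv_test {F : Type*} [NormedAddCommGroup F] [NormedSpace ℝ F]
    {φ : E n → F} (hc : HasCompactSupport φ) (v : E n) :
    HasCompactSupport (fun x => fderiv ℝ φ x v) :=
  hc.fderiv_apply (𝕜 := ℝ) v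

theorem IsWeakGradient.congr {u u' : E n → ℂ} {g g' : E n → EuclideanSpace ℂ (Fin n)}
    (h : IsWeakGradient u g) (hu : u' =ᵐ[volume] u) (hg : g' =ᵐ[volume] g) :
    IsWeakGradient u' g' := by
  intro j φ hφ hc
  rw [integral_congr_ae (g := fun x => (fderiv ℝ φ x (EuclideanSpace.single j 1)) • u x)
      (hu.mono fun x hx => by simp only [hx]),
    integral_congr_ae (f := fun x => φ x • g' x j) (g := fun x => φ x • g x j)
      (hg.mono fun x hx => by simp only [hx])]
  exact h j φ hφ hc

/-! ### The weighted Sobolev space -/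

/-- The weighted Sobolev space `H¹(μ) = {u ∈ L²(μ) | ∂₁u, …, ∂ₙu ∈ L²(μ)}`. An element is stored
as the pair `(u, du)` consisting of `u` and its distributional differential `du`, which is
determined by `u` (`H1.embedding_injective`). As a subspace of the Hilbert space sum
`L²(μ) ⊕ L²(μ, ∧¹ℂⁿ)` it carries the inner product `(u|w)_μ + (du|dw)_μ`. -/
def H1 (Φ : Potential n) : Submodule ℂ (WithLp 2 (L2 Φ × L2Form Φ)) where
  carrier := {p | IsWeakGradient (p.fst : E n → ℂ) (p.snd : E n → EuclideanSpace ℂ (Fin n))}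
  zero_mem' := by
    have h : IsWeakGradient (fun _ : E n => (0 : ℂ)) (fun _ => 0) := by
      intro j φ _ _
      simp
    exact h.congr (Φ.volume_ac.ae_eq (Lp.coeFn_zero ℂ 2 Φ.μ))
      (Φ.volume_ac.ae_eq (Lp.coeFn_zero _ 2 Φ.μ))
  add_mem' := by
    intro p q hp hq
    have h : IsWeakGradient (fun x => (p.fst : E n → ℂ) x + (q.fst : E n → ℂ) x)
        (fun x => (p.snd : E n → EuclideanSpace ℂ (Fin n)) x
          + (q.snd : E n → EuclideanSpace ℂ (Fin n)) x) := by
      intro j φ hφ hc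
      have hd := continuous_fderiv_test hφ (EuclideanSpace.single j 1)
      have hdc := hasCompactSupport_fderiv_test hc (EuclideanSpace.single j (1 : ℝ))
      simp only [smul_add, PiLp.add_apply]
      rw [integral_add (integrable_test_smul Φ p.fst hd hdc) (integrable_test_smul Φ q.fst hd hdc),
        integral_add (integrable_test_smul_apply Φ p.snd j hφ.continuous hc)
          (integrable_test_smul_apply Φ q.snd j hφ.continuous hc),
        hp j φ hφ hc, hq j φ hφ hc, neg_add]
    exact h.congr (Φ.volume_ac.ae_eq (Lp.coeFn_add p.fst q.fst))
      (Φ.volume_ac.ae_eq (Lp.coeFn_add p.snd q.snd))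
  smul_mem' := by
    intro c p hp
    have h : IsWeakGradient (fun x => c • (p.fst : E n → ℂ) x)
        (fun x => c • (p.snd : E n → EuclideanSpace ℂ (Fin n)) x) := by
      intro j φ hφ hc
      simp only [PiLp.smul_apply, smul_comm _ c]
      rw [integral_smul, integral_smul, hp j φ hφ hc, smul_neg]
    exact h.congr (Φ.volume_ac.ae_eq (Lp.coeFn_smul c p.fst))
      (Φ.volume_ac.ae_eq (Lp.coeFn_smul c p.snd))

/-- The embedding `H¹(μ) ↪ L²(μ)`, `u ↦ u`. -/
def H1.embedding (Φ : Potential n) : H1 Φ →L[ℂ] L2 Φ :=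
  (WithLp.fstL 2 ℂ (L2 Φ) (L2Form Φ)).comp (H1 Φ).subtypeL

/-- The exterior differential on functions, `d₀ : H¹(μ) → L²(μ, ∧¹ℂⁿ)`, `u ↦ du`. -/
def H1.d (Φ : Potential n) : H1 Φ →L[ℂ] L2Form Φ :=
  (WithLp.sndL 2 ℂ (L2 Φ) (L2Form Φ)).comp (H1 Φ).subtypeL

theorem H1.embedding_injective (Φ : Potential n) : Function.Injective (H1.embedding Φ) := by
  rw [injective_iff_map_eq_zero]
  intro w hw
  have h1 : (w : WithLp 2 (L2 Φ × L2Form Φ)).fst = 0 := hw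
  have hwk : IsWeakGradient ((w : WithLp 2 (L2 Φ × L2Form Φ)).fst : E n → ℂ)
    ((w : WithLp 2 (L2 Φ × L2Form Φ)).snd : E n → EuclideanSpace ℂ (Fin n)) := w.2
  have h0 : ((w : WithLp 2 (L2 Φ × L2Form Φ)).fst : E n → ℂ) =ᵐ[volume] 0 := by
    rw [h1]
    exact Φ.volume_ac.ae_eq (Lp.coeFn_zero ℂ 2 Φ.μ)
  set g := (w : WithLp 2 (L2 Φ × L2Form Φ)).snd with hg
  have h2 : ∀ j, ∀ᵐ x : E n, (g : E n → EuclideanSpace ℂ (Fin n)) x j = 0 := by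
    intro j
    refine ae_eq_zero_of_integral_contDiff_smul_eq_zero
      (f := fun x => (g : E n → EuclideanSpace ℂ (Fin n)) x j) ?_ ?_
    · have hl := locallyIntegrable_coeFn Φ g
      intro x
      obtain ⟨s, hs, hi⟩ := hl x
      exact ⟨s, hs, (EuclideanSpace.proj (𝕜 := ℂ) j).integrable_comp hi⟩
    · intro φ hφ hc
      have := hwk j φ hφ hc
      rw [integral_congr_ae (g := fun _ => (0 : ℂ)) (h0.mono fun x hx => by
        simp [hx]), integral_zero] at this
      simpa using this.symm
  have h3 : (g : E n → EuclideanSpace ℂ (Fin n)) =ᵐ[Φ.μ] 0 := by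
    refine (withDensity_absolutelyContinuous volume _).ae_eq ?_
    filter_upwards [ae_all_iff.2 h2] with x hx
    ext j
    simpa using hx j
  have h4 : g = 0 := (Lp.eq_zero_iff_ae_eq_zero).2 h3
  apply Subtype.ext
  apply (WithLp.ofLp_injective 2)
  exact Prod.ext h1 h4

/-- `H¹(μ)` is dense in `L²(μ)`, since it contains the test functions. -/
theorem H1.embedding_denseRange (Φ : Potential n) : DenseRange (H1.embedding Φ) := by
  refine (Lp.dense_hasCompactSupport_contDiff (F := ℂ) (μ := Φ.μ) (p := 2) (by simp)).mono ?_
  rintro f ⟨u, hfu, huc, hu⟩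
  let G : E n → EuclideanSpace ℂ (Fin n) :=
    fun x => WithLp.toLp 2 fun j => fderiv ℝ u x (EuclideanSpace.single j 1)
  have hGcont : Continuous G := by
    refine (PiLp.continuous_toLp 2 _).comp (continuous_pi fun j => ?_)
    exact continuous_fderiv_test hu _
  have hGc : HasCompactSupport G := by
    refine (huc.fderiv (𝕜 := ℝ)).mono ?_
    intro x hx h0
    apply hx
    ext j
    simp [G, h0]
  have hGL : MemLp G 2 Φ.μ := hGcont.memLp_of_hasCompactSupport hGc
  have hw : IsWeakGradient u G := by
    intro j φ hφ hc
    have := integral_smul_fderiv_eq_neg_fderiv_smul_of_integrable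
      (f := φ) (g := u) (v := EuclideanSpace.single j (1 : ℝ)) (μ := (volume : Measure (E n)))
      (((continuous_fderiv_test hφ _).smul hu.continuous).integrable_of_hasCompactSupport
        (hasCompactSupport_fderiv_test hc _).smul_right)
      ((hφ.continuous.smul (continuous_fderiv_test hu _)).integrable_of_hasCompactSupport
        hc.smul_right)
      ((hφ.continuous.smul hu.continuous).integrable_of_hasCompactSupport hc.smul_right)
      (fun x _ => hφ.contDiffAt.differentiableAt (by simp))
      (fun x _ => hu.contDiffAt.differentiableAt (by simp))
    simp only [G]
    rw [this, neg_neg]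
  refine ⟨⟨WithLp.toLp 2 (f, hGL.toLp G), ?_⟩, rfl⟩
  exact hw.congr (Φ.volume_ac.ae_eq hfu) (Φ.volume_ac.ae_eq hGL.coeFn_toLp)

/-! ### The operator `A₀` -/

/-- The graph of `A₀`: all `(u, f) ∈ L²(μ) × L²(μ)` with `u ∈ H¹(μ)` and
`a₀(u, w) = (du|dw)_μ = (f|w)_μ` for all `w ∈ H¹(μ)`.  (Mathlib's `inner ℂ` is antilinear in its
first argument, whence the order of the arguments.) -/
def A₀Graph (Φ : Potential n) : Submodule ℂ (L2 Φ × L2 Φ) where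
  carrier := {p | ∃ u : H1 Φ, H1.embedding Φ u = p.1 ∧
    ∀ w : H1 Φ, inner ℂ (H1.d Φ w) (H1.d Φ u) = inner ℂ (H1.embedding Φ w) p.2}
  zero_mem' := ⟨0, by simp, by simp⟩
  add_mem' := by
    rintro p q ⟨u, hu, hu'⟩ ⟨v, hv, hv'⟩
    refine ⟨u + v, by simp [hu, hv], fun w => ?_⟩
    simp [inner_add_right, hu', hv']
  smul_mem' := by
    rintro c p ⟨u, hu, hu'⟩
    refine ⟨c • u, by simp [hu], fun w => ?_⟩
    simp [inner_smul_right, hu']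

/-- The operator `A₀ = -Δ + Φ'·∇` in `L²(μ)`, defined variationally from the triple
`(L²(μ), H¹(μ), a₀)` with `a₀(u, w) = (du|dw)_μ`: it is the unbounded operator with
`D(A₀) = {u ∈ H¹(μ) | ∃ f ∈ L²(μ), ∀ w ∈ H¹(μ), a₀(u, w) = (f|w)_μ}` and `A₀ u = f`. -/
def A₀ (Φ : Potential n) : L2 Φ →ₗ.[ℂ] L2 Φ := (A₀Graph Φ).toLinearPMap

/-- `A₀` is well defined: its graph is the prescribed one. -/
theorem A₀_graph (Φ : Potential n) : (A₀ Φ).graph = A₀Graph Φ := by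
  refine Submodule.toLinearPMap_graph_eq _ ?_
  rintro ⟨u, f⟩ ⟨v, hv, hv'⟩ h0
  have hv0 : v = 0 := H1.embedding_injective Φ (by
    rw [hv, map_zero]
    exact h0)
  subst hv0
  have key : ∀ w : L2 Φ, inner ℂ w f = 0 := by
    refine isClosed_property (H1.embedding_denseRange Φ)
      (isClosed_eq (by fun_prop) continuous_const) fun w => ?_
    have := hv' w
    simpa using this.symm
  exact inner_self_eq_zero.1 (key f)

end WittenLaplacian

/-! ### Spectra of unbounded operators -/

namespace UnboundedOperator

variable {H : Type*} [NormedAddCommGroup H] [InnerProductSpace ℂ H]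

/-- The resolvent set `ρ(T)`: those `z` for which `T - z : D(T) → H` has a bounded, everywhere
defined inverse `R`. -/
def resolventSet (T : H →ₗ.[ℂ] H) : Set ℂ :=
  {z | ∃ R : H →L[ℂ] H,
    (∀ y : H, ∃ x : T.domain, (x : H) = R y ∧ T x - z • (x : H) = y) ∧
    ∀ x : T.domain, R (T x - z • (x : H)) = x}

/-- The spectrum `σ(T)`. -/
def spectrum (T : H →ₗ.[ℂ] H) : Set ℂ := (resolventSet T)ᶜ

/-- The eigenspace `Z(T - z)`, as a subspace of `D(T)`. -/
def eigenspace (T : H →ₗ.[ℂ] H) (z : ℂ) : Submodule ℂ T.domain :=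
  LinearMap.ker (T.toFun - z • T.domain.subtype)

/-- The discrete spectrum `σ_disc(T)` of a self-adjoint operator: the isolated points of the
spectrum that are eigenvalues of finite multiplicity. -/
def discreteSpectrum (T : H →ₗ.[ℂ] H) : Set ℂ :=
  {z | z ∈ spectrum T ∧ (∀ᶠ y in 𝓝[≠] z, y ∉ spectrum T) ∧
    eigenspace T z ≠ ⊥ ∧ FiniteDimensional ℂ (eigenspace T z)}

/-- The essential spectrum `σ_ess(T) = σ(T) \ σ_disc(T)` of a self-adjoint operator. -/
def essentialSpectrum (T : H →ₗ.[ℂ] H) : Set ℂ := spectrum T \ discreteSpectrum T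

end UnboundedOperator

end

open MeasureTheory Filter Topology
open scoped ContDiff ENNReal

noncomputable section

/-! Compactness rests on a weighted estimate. For a test function `φ`, the derivative `∂ⱼ(|φ|² ∂ⱼΦ
e^{-Φ})` has integral zero, so `∫ ((∂ⱼΦ)² - ∂ⱼ²Φ)|φ|² dμ = 2 ∫ Re(φ̄ ∂ⱼφ) ∂ⱼΦ dμ`. Young's
inequality bounds the right side by `(1-θ) ∫ (∂ⱼΦ)²|φ|² dμ + (1-θ)⁻¹ ∫ |∂ⱼφ|² dμ`. Absorbing the
first term and summing over `j` gives `∫ (θ|Φ'|² - ΔΦ)|φ|² dμ ≤ (1-θ)⁻¹ ‖dφ‖²`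
(`integral_weight_le`). As the weight tends to infinity, the mass of `φ` outside a large ball is at
most a small multiple of `‖φ‖²` in `H¹(μ)` (`exists_tail_le`).

On a ball `e^{-Φ}` lies between positive constants, so Lebesgue estimates apply there: replacing a
cut-off function by its averages over a grid of mesh `h` costs `O(h)` times its `H¹(μ)` norm
(`exists_local_approx`), and averaging over finitely many cells is a finite rank operator
(`exists_gridOperator`). Test functions are dense in `H¹(μ)` (`H1.dense_test`), so the embedding `J`
is a norm limit of compact operators.

For the spectrum, the weak formulation says that `(A₀ + 1)⁻¹ = J J*`, which is compact and
symmetric. The Fredholm alternative, together with the fact that nonzero eigenvalues of such an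
operator are isolated and of finite multiplicity, then leaves only discrete spectrum. -/

namespace UnboundedOperator

/-! ### Operators with compact symmetric resolvent. -/

section CompactSymmetric

variable {H : Type*} [NormedAddCommGroup H] [InnerProductSpace ℂ H]

/-- The eigenvalues of a compact symmetric operator do not accumulate at nonzero points. -/
theorem eventually_not_hasEigenvalue [CompleteSpace H] {G : H →L[ℂ] H} (hG : IsCompactOperator G)
    (hs : (G : H →ₗ[ℂ] H).IsSymmetric) {μ : ℂ} (hμ : μ ≠ 0) :
    ∀ᶠ ν in 𝓝[≠] μ, ¬ Module.End.HasEigenvalue (G : Module.End ℂ H) ν := by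
  set V : Submodule ℂ H := Module.End.eigenspace (G : Module.End ℂ H) μ with hV
  have hfin : FiniteDimensional ℂ V :=
    ContinuousLinearMap.finite_dimensional_eigenspace hG μ hμ
  set P : H →L[ℂ] H := V.starProjection with hP
  have hPc : IsCompactOperator P := by
    have h1 : IsCompactOperator (V.orthogonalProjectionOnto : H →L[ℂ] V) :=
      isCompactOperator_of_locallyCompactSpace_dom _
    exact h1.clm_comp V.subtypeL
  -- `G'` is still compact but kills the `μ`-eigenspace, so `μ` lies in its open resolvent set.
  -- Eigenvectors of `G` for `ν ≠ μ` are orthogonal to `V`, hence remain eigenvectors of `G'`; so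
  -- such `ν` stay away from `μ`.
  set G' : H →L[ℂ] H := G - μ • P with hG'
  have hc' : IsCompactOperator G' := hG.sub (hPc.smul μ)
  have hne : ¬ Module.End.HasEigenvalue (G' : Module.End ℂ H) μ := by
    intro h
    obtain ⟨x, hx⟩ := h.exists_hasEigenvector
    have hx1 : G x - μ • P x = μ • x := hx.apply_eq_smul
    have hPx : P x = 0 := by
      have hmem : P x ∈ V := V.starProjection_apply_mem x
      have hGP : G (P x) = μ • P x := Module.End.mem_eigenspace_iff.1 hmem
      have h1 : inner ℂ (P x) (G x) = inner ℂ (μ • P x) x := by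
        rw [← hGP]; exact (hs (P x) x).symm
      have hreal : starRingEnd ℂ μ = μ ∨ P x = 0 := by
        by_cases h0 : P x = 0
        · exact Or.inr h0
        · exact Or.inl (hs.conj_eigenvalue_eq_self
            (Module.End.hasEigenvalue_of_hasEigenvector ⟨hmem, h0⟩))
      rcases hreal with hr | h0
      -- By symmetry and reality of `μ`, `⟨P x, G x⟩ = μ⟨P x, x⟩`, which cancels the right side and
      -- leaves `μ‖P x‖² = 0`.
      · have h2 : inner ℂ (P x) (G x - μ • P x) = inner ℂ (P x) (μ • x) := by rw [hx1]
        rw [inner_sub_right, h1, inner_smul_left, hr, inner_smul_right, inner_smul_right,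
          sub_eq_self, mul_eq_zero] at h2
        rcases h2 with h2 | h2
        · exact absurd h2 hμ
        · exact inner_self_eq_zero.1 h2
      · exact h0
    rw [hPx, smul_zero, sub_zero] at hx1
    have hxV : x ∈ V := Module.End.mem_eigenspace_iff.2 hx1
    exact hx.2 (by rw [← Submodule.starProjection_eq_self_iff.2 hxV]; exact hPx)
  have hres : μ ∈ _root_.resolventSet ℂ G' :=
    (hc'.hasEigenvalue_or_mem_resolventSet hμ).resolve_left hne
  have hev : ∀ᶠ ν in 𝓝 μ, ν ∈ _root_.resolventSet ℂ G' :=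
    (spectrum.isOpen_resolventSet G').mem_nhds hres
  filter_upwards [hev.filter_mono nhdsWithin_le_nhds, self_mem_nhdsWithin] with ν hν hνμ hE
  obtain ⟨x, hx⟩ := hE.exists_hasEigenvector
  have hx1 : G x = ν • x := hx.apply_eq_smul
  have hPx : P x = 0 := by
    have hof := hs.orthogonalFamily_eigenspaces
    have hperp : x ∈ Vᗮ := by
      rw [Submodule.mem_orthogonal]
      intro v hv
      exact hof (Ne.symm hνμ) ⟨v, hv⟩ ⟨x, hx.1⟩
    exact (Submodule.starProjection_apply_eq_zero_iff (K := V)).2 hperp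
  have : Module.End.HasEigenvalue (G' : Module.End ℂ H) ν := by
    refine Module.End.hasEigenvalue_of_hasEigenvector (x := x)
      ⟨Module.End.mem_eigenspace_iff.2 ?_, hx.2⟩
    simp [hG', hPx, hx1]
  have h3 := this.mem_spectrum
  rw [← ContinuousLinearMap.spectrum_eq] at h3
  exact h3 hν

/-- `G = (T + 1)⁻¹`. -/
def IsResolventAtNegOne (T : H →ₗ.[ℂ] H) (G : H →L[ℂ] H) : Prop :=
  ∀ p : H × H, p ∈ T.graph ↔ p.1 = G (p.2 + p.1)

variable {T : H →ₗ.[ℂ] H} {G : H →L[ℂ] H}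

theorem IsResolventAtNegOne.apply_domain (h : IsResolventAtNegOne T G) (x : T.domain) :
    G (T x + x) = x :=
  ((h (x, T x)).1 (T.mem_graph x)).symm

theorem IsResolventAtNegOne.exists_domain (h : IsResolventAtNegOne T G) (y : H) :
    ∃ x : T.domain, (x : H) = G y ∧ T x = y - G y := by
  have : (G y, y - G y) ∈ T.graph := (h _).2 (by simp)
  obtain ⟨x, hx1, hx2⟩ := T.mem_graph_iff.1 this
  exact ⟨x, hx1, hx2⟩

/-- On `D(T)` one has `T - z = (1 - (z+1)G)(T + 1)`, so a bounded inverse `S` of `1 - (z+1)G` yields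
the resolvent `G S`. By the Fredholm alternative for compact `G`, such an `S` can only be missing
when `(z+1)⁻¹` is an eigenvalue; at `z = -1` the identity serves as `S`. -/
theorem IsResolventAtNegOne.hasEigenvalue_of_mem_spectrum [CompleteSpace H]
    (h : IsResolventAtNegOne T G)
    (hG : IsCompactOperator G) {z : ℂ} (hz : z ∈ spectrum T) :
    z + 1 ≠ 0 ∧ Module.End.HasEigenvalue (G : Module.End ℂ H) (z + 1)⁻¹ := by
  have key : ∀ S : H →L[ℂ] H, (∀ y, (S y - (z + 1) • G (S y)) = y) →
      (∀ y, S (y - (z + 1) • G y) = y) → z ∈ resolventSet T := by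
    intro S h1 h2
    refine ⟨G.comp S, fun y => ?_, fun x => ?_⟩
    · obtain ⟨x, hx, hTx⟩ := h.exists_domain (S y)
      refine ⟨x, hx, ?_⟩
      rw [hTx, hx]
      conv_rhs => rw [← h1 y]
      module
    · have hx := h.apply_domain x
      have : T x - z • (x : H) = (T x + x) - (z + 1) • G (T x + x) := by
        rw [hx]; module
      rw [this, ContinuousLinearMap.comp_apply, h2, hx]
  by_contra hcon
  apply hz
  by_cases h0 : z + 1 = 0
  · exact key (ContinuousLinearMap.id ℂ H) (by simp [h0]) (by simp [h0])
  · have hne : ¬ Module.End.HasEigenvalue (G : Module.End ℂ H) (z + 1)⁻¹ :=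
      fun h' => hcon ⟨h0, h'⟩
    have hres := (hG.hasEigenvalue_or_mem_resolventSet (inv_ne_zero h0)).resolve_left hne
    rw [spectrum.mem_resolventSet_iff] at hres
    obtain ⟨u, hu⟩ := hres
    have hu' : ∀ y, (u : H →L[ℂ] H) y = (z + 1)⁻¹ • y - G y := by
      intro y; rw [hu]; simp [Algebra.algebraMap_eq_smul_one]
    have e1 : ∀ y, (u : H →L[ℂ] H) ((↑u⁻¹ : H →L[ℂ] H) y) = y := fun y => by
      rw [← mul_apply_eq_comp, Units.mul_inv]; rfl
    have e2 : ∀ y, (↑u⁻¹ : H →L[ℂ] H) ((u : H →L[ℂ] H) y) = y := fun y => by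
      rw [← mul_apply_eq_comp, Units.inv_mul]; rfl
    refine key ((z + 1)⁻¹ • (↑u⁻¹ : H →L[ℂ] H)) (fun y => ?_) (fun y => ?_)
    · have := e1 y
      rw [hu'] at this
      simp only [smul_apply, map_smul, smul_smul, mul_inv_cancel₀ h0,
        one_smul]
      exact this
    · have : y - (z + 1) • G y = (z + 1) • (u : H →L[ℂ] H) y := by
        rw [hu', smul_sub, smul_smul, mul_inv_cancel₀ h0, one_smul]
      rw [this, smul_apply, map_smul, smul_smul, inv_mul_cancel₀ h0, one_smul,
        e2]

/-- A closed operator with compact symmetric resolvent has no essential spectrum. -/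
theorem IsResolventAtNegOne.essentialSpectrum_eq_empty [CompleteSpace H]
    (h : IsResolventAtNegOne T G)
    (hG : IsCompactOperator G) (hs : (G : H →ₗ[ℂ] H).IsSymmetric) :
    essentialSpectrum T = ∅ := by
  rw [essentialSpectrum, Set.sdiff_eq_empty]
  intro z hz
  obtain ⟨h0, hE⟩ := h.hasEigenvalue_of_mem_spectrum hG hz
  refine ⟨hz, ?_, ?_, ?_⟩
  -- Isolation is pulled back along the injective map `y ↦ (y+1)⁻¹`, continuous at `z`.
  · have hev := eventually_not_hasEigenvalue hG hs (inv_ne_zero h0)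
    rw [eventually_nhdsWithin_iff] at hev ⊢
    have hcont : ContinuousAt (fun y : ℂ => (y + 1)⁻¹) z :=
      (continuousAt_id.add continuousAt_const).inv₀ h0
    filter_upwards [hcont.eventually hev] with y hy hyz hys
    obtain ⟨hy0, hyE⟩ := h.hasEigenvalue_of_mem_spectrum hG hys
    exact hy (fun he => hyz (add_right_cancel (inv_injective he))) hyE
  -- An eigenvector satisfies `e = G((z+1)e)`, so it lies in the range of `G`, which is `D(T)`.
  · obtain ⟨e, he⟩ := hE.exists_hasEigenvector
    have hGe : G e = (z + 1)⁻¹ • e := he.apply_eq_smul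
    obtain ⟨x, hx, hTx⟩ := h.exists_domain ((z + 1) • e)
    have hxe : (x : H) = e := by rw [hx, map_smul, hGe, smul_smul, mul_inv_cancel₀ h0, one_smul]
    rw [Submodule.ne_bot_iff]
    refine ⟨x, ?_, fun hx0 => he.2 ?_⟩
    · rw [eigenspace, LinearMap.mem_ker]
      change T x - z • (x : H) = 0
      rw [hTx, ← hx, hxe]
      module
    · rw [← hxe, hx0]; rfl
  · have hfin : FiniteDimensional ℂ (Module.End.eigenspace (G : Module.End ℂ H) (z + 1)⁻¹) :=
      ContinuousLinearMap.finite_dimensional_eigenspace hG _ (inv_ne_zero h0)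
    let f : eigenspace T z →ₗ[ℂ] Module.End.eigenspace (G : Module.End ℂ H) (z + 1)⁻¹ :=
      (T.domain.subtype.comp (eigenspace T z).subtype).codRestrict _ (by
        intro x
        rw [Module.End.mem_eigenspace_iff]
        have hx : T x.1 - z • (x.1 : H) = 0 := LinearMap.mem_ker.1 x.2
        have h1 := h.apply_domain x.1
        have h2 : T x.1 + (x.1 : H) = (z + 1) • (x.1 : H) := by
          rw [sub_eq_zero.1 hx]; module
        rw [h2, map_smul] at h1
        change G (x.1 : H) = (z + 1)⁻¹ • (x.1 : H)
        conv_rhs => rw [← h1]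
        rw [smul_smul, inv_mul_cancel₀ h0, one_smul])
    refine FiniteDimensional.of_injective f fun x y hxy => ?_
    refine Subtype.ext (Subtype.ext ?_)
    exact congrArg (fun v : Module.End.eigenspace (G : Module.End ℂ H) (z + 1)⁻¹ => (v : H)) hxy

end CompactSymmetric

end UnboundedOperator

namespace WittenLaplacian

variable {n : ℕ}

/-! ### Completeness of `H¹(μ)` and the resolvent of `A₀`. -/

theorem Potential.integral_μ {F : Type*} [NormedAddCommGroup F] [NormedSpace ℝ F]
    (Φ : Potential n) (f : E n → F) : ∫ x, f x ∂Φ.μ = ∫ x, Real.exp (-Φ x) • f x := by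
  rw [Potential.μ, integral_withDensity_eq_integral_toReal_smul Φ.measurable_density
    (Eventually.of_forall fun x => ENNReal.ofReal_lt_top)]
  simp [ENNReal.toReal_ofReal (Real.exp_pos _).le]

/-- Pairing with a function `ψ` such that `ψ e^Φ ∈ L²(μ)` is a bounded functional on `L²(μ)`. -/
theorem exists_functional (Φ : Potential n) {ψ : E n → ℝ}
    (hL : MemLp (fun x => ((ψ x * Real.exp (Φ x) : ℝ) : ℂ)) 2 Φ.μ) :
    ∃ F : L2 Φ →L[ℂ] ℂ, ∀ u : L2 Φ, F u = ∫ x, ψ x • (u : E n → ℂ) x := by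
  -- The representing vector is `ψ e^Φ`: its exponential cancels the density of `μ`.
  refine ⟨innerSL ℂ (hL.toLp _), fun u => ?_⟩
  rw [innerSL_apply_apply, L2.inner_def, Φ.integral_μ]
  refine integral_congr_ae ?_
  filter_upwards [Φ.volume_ac.ae_eq hL.coeFn_toLp] with x hx
  rw [hx, RCLike.inner_apply]
  simp only [Complex.conj_ofReal, Complex.real_smul]
  have : Complex.exp (-(Φ x : ℂ)) * Complex.exp (Φ x : ℂ) = 1 := by
    rw [← Complex.exp_add]; simp
  push_cast
  linear_combination (ψ x * u x : ℂ) * this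

theorem memLp_mul_exp (Φ : Potential n) {ψ : E n → ℝ} (hψ : Continuous ψ)
    (hc : HasCompactSupport ψ) : MemLp (fun x => ((ψ x * Real.exp (Φ x) : ℝ) : ℂ)) 2 Φ.μ :=
  Continuous.memLp_of_hasCompactSupport (Complex.continuous_ofReal.comp
    (hψ.mul (Real.continuous_exp.comp Φ.continuous))) (hc.mono fun x hx h0 => hx (by simp [h0]))

/-- Pairing with a test function is a bounded functional on `L²(μ)`. -/
theorem exists_testFunctional (Φ : Potential n) {ψ : E n → ℝ} (hψ : Continuous ψ)
    (hc : HasCompactSupport ψ) :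
    ∃ F : L2 Φ →L[ℂ] ℂ, ∀ u : L2 Φ, F u = ∫ x, ψ x • (u : E n → ℂ) x :=
  exists_functional Φ (memLp_mul_exp Φ hψ hc)

/-- The `j`-th component of a `1`-form. -/
def L2Form.component (Φ : Potential n) (j : Fin n) : L2Form Φ →L[ℂ] L2 Φ :=
  (EuclideanSpace.proj (𝕜 := ℂ) j).compLpL 2 Φ.μ

theorem L2Form.coeFn_component (Φ : Potential n) (j : Fin n) (g : L2Form Φ) :
    (L2Form.component Φ j g : E n → ℂ) =ᵐ[volume]
      fun x => (g : E n → EuclideanSpace ℂ (Fin n)) x j :=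
  Φ.volume_ac.ae_eq (ContinuousLinearMap.coeFn_compLpL _ g)

/-- For fixed `j` and `φ`, both sides of the weak derivative identity are bounded functionals, so
`H¹(μ)` is an intersection of closed sets. The resulting completeness is what makes the adjoint of
the embedding available. -/
theorem H1.isClosed (Φ : Potential n) :
    IsClosed (H1 Φ : Set (WithLp 2 (L2 Φ × L2Form Φ))) := by
  have : (H1 Φ : Set (WithLp 2 (L2 Φ × L2Form Φ))) =
      ⋂ (j : Fin n) (φ : E n → ℝ) (_ : ContDiff ℝ ∞ φ) (_ : HasCompactSupport φ),
        {p | ∫ x, (fderiv ℝ φ x (EuclideanSpace.single j 1)) • (p.fst : E n → ℂ) x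
          = - ∫ x, φ x • (p.snd : E n → EuclideanSpace ℂ (Fin n)) x j} := by
    ext p
    simp only [Set.mem_iInter]
    rfl
  rw [this]
  refine isClosed_iInter fun j => isClosed_iInter fun φ => isClosed_iInter fun hφ =>
    isClosed_iInter fun hc => ?_
  obtain ⟨F₁, hF₁⟩ := exists_testFunctional Φ
    (continuous_fderiv_test hφ (EuclideanSpace.single j (1 : ℝ)))
    (hasCompactSupport_fderiv_test hc _)
  obtain ⟨F₂, hF₂⟩ := exists_testFunctional Φ hφ.continuous hc
  have h2 : ∀ g : L2Form Φ, ∫ x, φ x • (g : E n → EuclideanSpace ℂ (Fin n)) x j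
      = F₂ (L2Form.component Φ j g) := fun g => by
    rw [hF₂]
    exact integral_congr_ae ((L2Form.coeFn_component Φ j g).mono fun x hx => by simp only [hx])
  simp only [h2, ← hF₁]
  exact isClosed_eq (F₁.continuous.comp (WithLp.fstL 2 ℂ (L2 Φ) (L2Form Φ)).continuous)
    ((F₂.comp (L2Form.component Φ j)).continuous.comp
      (WithLp.sndL 2 ℂ (L2 Φ) (L2Form Φ)).continuous).neg

instance (Φ : Potential n) : CompleteSpace (H1 Φ) := (H1.isClosed Φ).completeSpace_coe

theorem H1.inner_eq (Φ : Potential n) (v w : H1 Φ) : inner ℂ v w =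
    inner ℂ (H1.embedding Φ v) (H1.embedding Φ w) + inner ℂ (H1.d Φ v) (H1.d Φ w) :=
  WithLp.prod_inner_apply _ _

/-- `A₀ + 1` is inverted by `J J*`, where `J` is the embedding of `H¹(μ)` into `L²(μ)`. -/
theorem A₀_isResolventAtNegOne (Φ : Potential n) :
    UnboundedOperator.IsResolventAtNegOne (A₀ Φ)
      ((H1.embedding Φ).comp (ContinuousLinearMap.adjoint (H1.embedding Φ))) := by
  rintro ⟨u, f⟩
  rw [A₀_graph]
  change (∃ v : H1 Φ, H1.embedding Φ v = u ∧
    ∀ w : H1 Φ, inner ℂ (H1.d Φ w) (H1.d Φ v) = inner ℂ (H1.embedding Φ w) f) ↔ _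
  constructor
  -- Adding `(v|w)_μ` to both sides of `a₀(v, w) = (f|w)_μ` turns the left one into the `H¹(μ)`
  -- inner product, so the equation reads `v = J*(f + J v)`.
  · rintro ⟨v, rfl, hv⟩
    have : v = ContinuousLinearMap.adjoint (H1.embedding Φ) (f + H1.embedding Φ v) := by
      refine ext_inner_left ℂ fun w => ?_
      rw [ContinuousLinearMap.adjoint_inner_right, H1.inner_eq, hv, inner_add_right, add_comm]
    exact congrArg (H1.embedding Φ) this
  · intro h
    refine ⟨ContinuousLinearMap.adjoint (H1.embedding Φ) (f + u), h.symm, fun w => ?_⟩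
    have h1 := ContinuousLinearMap.adjoint_inner_right (H1.embedding Φ) w (f + u)
    have h2 : H1.embedding Φ (ContinuousLinearMap.adjoint (H1.embedding Φ) (f + u)) = u := h.symm
    rw [H1.inner_eq, h2, inner_add_right, add_comm] at h1
    exact add_right_cancel h1

theorem essentialSpectrum_A₀_eq_empty (Φ : Potential n)
    (h : IsCompactOperator (H1.embedding Φ)) :
    UnboundedOperator.essentialSpectrum (A₀ Φ) = ∅ := by
  refine (A₀_isResolventAtNegOne Φ).essentialSpectrum_eq_empty (h.comp_clm _) fun u v => ?_
  change inner ℂ (H1.embedding Φ (ContinuousLinearMap.adjoint (H1.embedding Φ) u)) v =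
    inner ℂ u (H1.embedding Φ (ContinuousLinearMap.adjoint (H1.embedding Φ) v))
  exact (ContinuousLinearMap.adjoint_inner_right (H1.embedding Φ) _ v).symm.trans
    (ContinuousLinearMap.adjoint_inner_left (H1.embedding Φ) _ u)

/-! ### Translations and mollifiers in `L²` of Lebesgue measure. -/

/-- Cauchy–Schwarz against the constant `1`. It serves for averages over a segment, over a mollifier
and over a grid cell. -/
theorem sq_lintegral_le_lintegral_sq {α : Type*} [MeasurableSpace α] (ν : Measure α)
    [IsProbabilityMeasure ν] {g : α → ℝ≥0∞} (hg : AEMeasurable g ν) :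
    (∫⁻ x, g x ∂ν) ^ 2 ≤ ∫⁻ x, g x ^ 2 ∂ν := by
  have h := ENNReal.lintegral_mul_le_Lp_mul_Lq ν Real.HolderConjugate.two_two hg
    (aemeasurable_const (b := (1 : ℝ≥0∞)))
  simp only [Pi.mul_apply, mul_one, ENNReal.one_rpow, lintegral_const, measure_univ] at h
  calc (∫⁻ x, g x ∂ν) ^ 2 ≤ ((∫⁻ x, g x ^ (2 : ℝ) ∂ν) ^ (1 / (2 : ℝ))) ^ 2 := by gcongr
    _ = ∫⁻ x, g x ^ 2 ∂ν := by
      rw [← ENNReal.rpow_natCast, ← ENNReal.rpow_mul]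
      simp

/-- The squared `L²` difference quotient bound for translations of a `C¹` function. -/
theorem lintegral_translate_sub_le {F : Type*} [NormedAddCommGroup F] [NormedSpace ℝ F]
    [CompleteSpace F] {v : E n → F} (hv : ContDiff ℝ 1 v) (h : E n) :
    ∫⁻ x, ‖v (x + h) - v x‖ₑ ^ 2 ≤ ‖h‖ₑ ^ 2 * ∫⁻ x, ‖fderiv ℝ v x‖ₑ ^ 2 := by
  have hcont : Continuous (fderiv ℝ v) := hv.continuous_fderiv (by norm_num)
  -- The increment of `v` is an average of its derivative over a segment. After Tonelli, translation
  -- invariance removes the shift `t • h`.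
  let ν : Measure ℝ := volume.restrict (Set.Ioc 0 1)
  have hν : IsProbabilityMeasure ν := ⟨by simp [ν]⟩
  have hpt : ∀ x, ‖v (x + h) - v x‖ₑ ^ 2 ≤
      ∫⁻ t, ‖h‖ₑ ^ 2 * ‖fderiv ℝ v (x + t • h)‖ₑ ^ 2 ∂ν := by
    intro x
    have hc : Continuous fun t : ℝ => fderiv ℝ v (x + t • h) h :=
      (hcont.comp (by fun_prop)).clm_apply continuous_const
    have h1 : v (x + h) - v x = ∫ t in (0 : ℝ)..1, fderiv ℝ v (x + t • h) h := by
      rw [intervalIntegral.integral_eq_sub_of_hasDerivAt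
        (f := fun t : ℝ => v (x + t • h)) (f' := fun t => fderiv ℝ v (x + t • h) h)
        (fun t _ => ?_) (hc.intervalIntegrable _ _)]
      · simp
      · have hd : HasDerivAt (fun t : ℝ => x + t • h) h t := by
          simpa using ((hasDerivAt_id t).smul_const h).const_add x
        exact ((hv.differentiable (by norm_num)).differentiableAt.hasFDerivAt).comp_hasDerivAt t hd
    rw [h1, intervalIntegral.integral_of_le zero_le_one]
    calc ‖∫ t in Set.Ioc (0 : ℝ) 1, fderiv ℝ v (x + t • h) h‖ₑ ^ 2
        ≤ (∫⁻ t, ‖fderiv ℝ v (x + t • h) h‖ₑ ∂ν) ^ 2 := by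
          gcongr; exact enorm_integral_le_lintegral_enorm _
      _ ≤ ∫⁻ t, ‖fderiv ℝ v (x + t • h) h‖ₑ ^ 2 ∂ν :=
          sq_lintegral_le_lintegral_sq ν hc.enorm.measurable.aemeasurable
      _ ≤ _ := by
          refine lintegral_mono fun t => ?_
          rw [← mul_pow, mul_comm ‖h‖ₑ]
          gcongr
          exact ContinuousLinearMap.le_opENorm _ _
  calc ∫⁻ x, ‖v (x + h) - v x‖ₑ ^ 2
      ≤ ∫⁻ x, ∫⁻ t, ‖h‖ₑ ^ 2 * ‖fderiv ℝ v (x + t • h)‖ₑ ^ 2 ∂ν := lintegral_mono hpt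
    _ = ∫⁻ t, ∫⁻ x, ‖h‖ₑ ^ 2 * ‖fderiv ℝ v (x + t • h)‖ₑ ^ 2 ∂volume ∂ν := by
        refine lintegral_lintegral_swap (Measurable.aemeasurable ?_)
        refine Measurable.const_mul ?_ _
        refine Measurable.pow_const (Continuous.measurable ?_) _
        exact (hcont.comp (by fun_prop)).enorm
    _ = ∫⁻ t, ‖h‖ₑ ^ 2 * ∫⁻ x, ‖fderiv ℝ v x‖ₑ ^ 2 ∂volume ∂ν := by
        refine lintegral_congr fun t => ?_
        have hm : Measurable fun x => ‖fderiv ℝ v (x + t • h)‖ₑ ^ 2 :=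
          (hcont.comp (continuous_id.add continuous_const)).enorm.measurable.pow_const 2
        rw [lintegral_const_mul _ hm,
          lintegral_add_right_eq_self (fun x => ‖fderiv ℝ v x‖ₑ ^ 2) (t • h)]
    _ = _ := by simp

open scoped Convolution in
/-- Mollification moves a function in `L²` by at most its translation modulus. -/
theorem lintegral_mollify_sub_le {F : Type*} [NormedAddCommGroup F] [NormedSpace ℝ F]
    [CompleteSpace F] (ρ : ContDiffBump (0 : E n)) {f : E n → F} (hf : LocallyIntegrable f)
    (hm : StronglyMeasurable f) {B : ℝ≥0∞}
    (hB : ∀ t, ‖t‖ < ρ.rOut → ∫⁻ x, ‖f (x - t) - f x‖ₑ ^ 2 ≤ B) :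
    ∫⁻ x, ‖(ρ.normed volume ⋆ f) x - f x‖ₑ ^ 2 ≤ B := by
  set r : E n → ℝ := ρ.normed volume with hr
  have hrc : Continuous r := ρ.continuous_normed
  have hrm : Measurable fun t => ENNReal.ofReal (r t) := (ENNReal.continuous_ofReal.comp hrc).measurable
  -- The mollifier is a probability density, so `r ⋆ f - f` is a `ν`-average of translation
  -- differences.
  let ν : Measure (E n) := volume.withDensity fun t => ENNReal.ofReal (r t)
  have hmass : ∫⁻ t, ENNReal.ofReal (r t) = 1 := by
    rw [← ofReal_integral_eq_lintegral_ofReal ρ.integrable_normed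
      (Eventually.of_forall ρ.nonneg_normed), ρ.integral_normed, ENNReal.ofReal_one]
  have hν : IsProbabilityMeasure ν := ⟨by simp [ν, withDensity_apply, hmass]⟩
  have hmeas : StronglyMeasurable fun p : E n × E n => f (p.1 - p.2) - f p.1 :=
    (hm.comp_measurable (measurable_fst.sub measurable_snd)).sub (hm.comp_measurable measurable_fst)
  have hpt : ∀ x, ‖(r ⋆ f) x - f x‖ₑ ^ 2 ≤ ∫⁻ t, ‖f (x - t) - f x‖ₑ ^ 2 ∂ν := by
    intro x
    have hex : Integrable fun t => r t • f (x - t) :=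
      (ρ.hasCompactSupport_normed.convolutionExists_left (ContinuousLinearMap.lsmul ℝ ℝ)
        hrc hf x)
    have h1 : (r ⋆ f) x - f x = ∫ t, r t • (f (x - t) - f x) := by
      simp only [smul_sub]
      rw [integral_sub hex (ρ.integrable_normed.smul_const _), integral_smul_const,
        ρ.integral_normed, one_smul]
      rfl
    have hmx : Measurable fun t => ‖f (x - t) - f x‖ₑ :=
      (hmeas.comp_measurable measurable_prodMk_left).enorm
    rw [h1]
    calc ‖∫ t, r t • (f (x - t) - f x)‖ₑ ^ 2
        ≤ (∫⁻ t, ‖r t • (f (x - t) - f x)‖ₑ) ^ 2 := by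
          gcongr; exact enorm_integral_le_lintegral_enorm _
      _ = (∫⁻ t, ‖f (x - t) - f x‖ₑ ∂ν) ^ 2 := by
          rw [lintegral_withDensity_eq_lintegral_mul _ hrm hmx]
          congr 1
          refine lintegral_congr fun t => ?_
          rw [enorm_smul, Real.enorm_of_nonneg (ρ.nonneg_normed t)]
          rfl
      _ ≤ _ := sq_lintegral_le_lintegral_sq ν hmx.aemeasurable
  calc ∫⁻ x, ‖(r ⋆ f) x - f x‖ₑ ^ 2
      ≤ ∫⁻ x, ∫⁻ t, ‖f (x - t) - f x‖ₑ ^ 2 ∂ν := lintegral_mono hpt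
    _ = ∫⁻ t, ∫⁻ x, ‖f (x - t) - f x‖ₑ ^ 2 ∂volume ∂ν :=
        lintegral_lintegral_swap (hmeas.enorm.pow_const 2).aemeasurable
    _ = ∫⁻ t, ENNReal.ofReal (r t) * ∫⁻ x, ‖f (x - t) - f x‖ₑ ^ 2 ∂volume := by
        refine lintegral_withDensity_eq_lintegral_mul _ hrm ?_
        exact Measurable.lintegral_prod_left' (f := fun p : E n × E n => ‖f (p.1 - p.2) - f p.1‖ₑ ^ 2)
          (hmeas.enorm.pow_const 2)
    _ ≤ ∫⁻ t, ENNReal.ofReal (r t) * B := by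
        refine lintegral_mono fun t => ?_
        by_cases ht : ‖t‖ < ρ.rOut
        · exact mul_le_mul_right (hB t ht) _
        · have : r t = 0 := by
            have := ρ.support_normed_eq (μ := (volume : Measure (E n)))
            by_contra h0
            have h2 : t ∈ Function.support (ρ.normed (volume : Measure (E n))) := h0
            rw [this, mem_ball_zero_iff] at h2
            exact ht h2
          simp [this]
    _ = B := by rw [lintegral_mul_const _ hrm, hmass, one_mul]

theorem eLpNorm_two_sq {α F : Type*} [MeasurableSpace α] [NormedAddCommGroup F] (μ : Measure α)
    (f : α → F) : eLpNorm f 2 μ ^ 2 = ∫⁻ x, ‖f x‖ₑ ^ 2 ∂μ := by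
  have := eLpNorm_nnreal_pow_eq_lintegral (μ := μ) (f := f) (p := 2) two_ne_zero
  simpa using this

/-- Translation is continuous in `L²`. -/
theorem tendsto_eLpNorm_translate_sub {F : Type*} [NormedAddCommGroup F]
    {f : E n → F} (hf : MemLp f 2 volume) :
    Tendsto (fun t => eLpNorm (fun x => f (x - t) - f x) 2 volume) (𝓝 0) (𝓝 0) := by
  let g : E n → C(E n, E n) := fun t => ⟨fun x => x - t, by fun_prop⟩
  have hg : Continuous g := ContinuousMap.continuous_of_continuous_uncurry _ (by
    change Continuous fun p : E n × E n => p.2 - p.1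
    fun_prop)
  have hgm : ∀ t, MeasurePreserving (g t) volume volume := fun t =>
    measurePreserving_sub_right volume t
  have h := Tendsto.compMeasurePreservingLp (l := 𝓝 (0 : E n)) (f := fun _ => hf.toLp f)
    tendsto_const_nhds (hg.tendsto 0) hgm (hgm 0) (by simp)
  rw [tendsto_iff_edist_tendsto_0] at h
  refine h.congr fun t => ?_
  rw [Lp.edist_def]
  refine eLpNorm_congr_ae ?_
  have e1 : ∀ s, (Lp.compMeasurePreserving (g s) (hgm s) (hf.toLp f) : E n → F) =ᵐ[volume]
      fun x => f (x - s) := fun s =>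
    (Lp.coeFn_compMeasurePreserving _ (hgm s)).trans
      ((hgm s).quasiMeasurePreserving.ae_eq_comp hf.coeFn_toLp)
  filter_upwards [e1 t, e1 0] with x h1 h2
  rw [Pi.sub_apply, h1, h2, sub_zero]

/-! ### Gradients of smooth functions -/

/-- The gradient of `φ`, as a `ℂⁿ`-valued function. -/
def formGrad (φ : E n → ℂ) (x : E n) : EuclideanSpace ℂ (Fin n) :=
  WithLp.toLp 2 fun j => fderiv ℝ φ x (EuclideanSpace.single j 1)

/-- The gradient of a real function `χ`, with values in `ℂⁿ`. -/
def realGrad (χ : E n → ℝ) (x : E n) : EuclideanSpace ℂ (Fin n) :=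
  WithLp.toLp 2 fun j => ((fderiv ℝ χ x (EuclideanSpace.single j 1) : ℝ) : ℂ)

theorem continuous_formGrad {φ : E n → ℂ} (hφ : ContDiff ℝ ∞ φ) : Continuous (formGrad φ) :=
  (PiLp.continuous_toLp 2 _).comp (continuous_pi fun _ => continuous_fderiv_test hφ _)

theorem hasCompactSupport_formGrad {φ : E n → ℂ} (hc : HasCompactSupport φ) :
    HasCompactSupport (formGrad φ) := by
  refine (hc.fderiv (𝕜 := ℝ)).mono fun x hx h0 => hx ?_
  ext j
  simp [formGrad, h0]

theorem continuous_realGrad {χ : E n → ℝ} (hχ : ContDiff ℝ ∞ χ) : Continuous (realGrad χ) :=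
  (PiLp.continuous_toLp 2 _).comp
    (continuous_pi fun _ => Complex.continuous_ofReal.comp (continuous_fderiv_test hχ _))

theorem hasCompactSupport_realGrad {χ : E n → ℝ} (hc : HasCompactSupport χ) :
    HasCompactSupport (realGrad χ) := by
  refine (hc.fderiv (𝕜 := ℝ)).mono fun x hx h0 => hx ?_
  ext j
  simp [realGrad, h0]

theorem isWeakGradient_formGrad {u : E n → ℂ} (hu : ContDiff ℝ ∞ u) :
    IsWeakGradient u (formGrad u) := by
  intro j φ hφ hc
  have := integral_smul_fderiv_eq_neg_fderiv_smul_of_integrable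
    (f := φ) (g := u) (v := EuclideanSpace.single j (1 : ℝ)) (μ := (volume : Measure (E n)))
    (((continuous_fderiv_test hφ _).smul hu.continuous).integrable_of_hasCompactSupport
      (hasCompactSupport_fderiv_test hc _).smul_right)
    ((hφ.continuous.smul (continuous_fderiv_test hu _)).integrable_of_hasCompactSupport
      hc.smul_right)
    ((hφ.continuous.smul hu.continuous).integrable_of_hasCompactSupport hc.smul_right)
    (fun x _ => hφ.contDiffAt.differentiableAt (by simp))
    (fun x _ => hu.contDiffAt.differentiableAt (by simp))
  simp only [formGrad]
  rw [this, neg_neg]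

theorem LocallyIntegrable.component {g : E n → EuclideanSpace ℂ (Fin n)}
    (hg : LocallyIntegrable g) (j : Fin n) : LocallyIntegrable fun x => g x j := by
  intro x
  obtain ⟨s, hs, hi⟩ := hg x
  exact ⟨s, hs, (EuclideanSpace.proj (𝕜 := ℂ) j).integrable_comp hi⟩

/-- The Leibniz rule for the product of a smooth function and a weakly differentiable one. -/
theorem IsWeakGradient.smul_smooth {u : E n → ℂ} {g : E n → EuclideanSpace ℂ (Fin n)}
    (h : IsWeakGradient u g) (hu : LocallyIntegrable u) (hg : LocallyIntegrable g)
    {χ : E n → ℝ} (hχ : ContDiff ℝ ∞ χ) :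
    IsWeakGradient (fun x => χ x • u x) (fun x => χ x • g x + u x • realGrad χ x) := by
  intro j φ hφ hc
  set e : E n := EuclideanSpace.single j (1 : ℝ) with he
  have hprod : ContDiff ℝ ∞ fun x => φ x * χ x := hφ.mul hχ
  have hpc : HasCompactSupport fun x => φ x * χ x := hc.mul_right
  -- The weak gradient of `u` is tested against `φχ`; the term carrying `∂ⱼχ` becomes the extra term
  -- of the Leibniz rule.
  have h1 := h j _ hprod hpc
  have hder : ∀ x, fderiv ℝ (fun x => φ x * χ x) x e = fderiv ℝ φ x e * χ x + φ x * fderiv ℝ χ x e := by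
    intro x
    rw [fderiv_fun_mul (hφ.contDiffAt.differentiableAt (by simp))
      (hχ.contDiffAt.differentiableAt (by simp))]
    simp
    ring
  have i1 : Integrable fun x => (fderiv ℝ φ x e * χ x) • u x :=
    hu.integrable_smul_left_of_hasCompactSupport
      ((continuous_fderiv_test hφ e).mul hχ.continuous)
      (hasCompactSupport_fderiv_test hc e).mul_right
  have i2 : Integrable fun x => (φ x * fderiv ℝ χ x e) • u x :=
    hu.integrable_smul_left_of_hasCompactSupport
      (hφ.continuous.mul (continuous_fderiv_test hχ e)) hc.mul_right
  have i3 : Integrable fun x => (φ x * χ x) • g x j :=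
    (LocallyIntegrable.component hg j).integrable_smul_left_of_hasCompactSupport
      hprod.continuous hpc
  simp only [← he, hder, add_smul] at h1
  rw [integral_add i1 i2] at h1
  have e1 : ∀ x, φ x • (χ x • g x + u x • realGrad χ x) j
      = (φ x * χ x) • g x j + (φ x * fderiv ℝ χ x e) • u x := by
    intro x
    simp only [PiLp.add_apply, PiLp.smul_apply, realGrad, Complex.real_smul, smul_eq_mul]
    push_cast
    ring
  simp only [e1, smul_smul]
  rw [integral_add i3 i2, neg_add, ← h1]
  ring

/-! ### Comparison of norms on compact sets -/

/-- `e^{-Φ}` is continuous and positive, hence bounded above and away from zero on compact sets.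
With the reverse comparison that follows, the two `L²` norms are equivalent for functions supported
in `K`. -/
theorem Potential.exists_restrict_μ_le (Φ : Potential n) {K : Set (E n)} (hK : IsCompact K) :
    ∃ C : ℝ≥0∞, C ≠ (⊤ : ℝ≥0∞) ∧ Φ.μ.restrict K ≤ C • volume := by
  obtain ⟨C, hC⟩ := (hK.image (Real.continuous_exp.comp Φ.continuous.neg)).bddAbove
  refine ⟨ENNReal.ofReal C, ENNReal.ofReal_ne_top, Measure.le_iff.2 fun s hs => ?_⟩
  rw [Measure.restrict_apply hs, Potential.μ, withDensity_apply _ (hs.inter hK.measurableSet)]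
  calc ∫⁻ x in s ∩ K, ENNReal.ofReal (Real.exp (-Φ x))
      ≤ ∫⁻ _ in s ∩ K, ENNReal.ofReal C :=
        setLIntegral_mono measurable_const fun x hx =>
          ENNReal.ofReal_le_ofReal (hC ⟨x, hx.2, rfl⟩)
    _ ≤ (ENNReal.ofReal C • (volume : Measure (E n))) s := by
        rw [lintegral_const, Measure.restrict_apply MeasurableSet.univ, Set.univ_inter,
          Measure.smul_apply, smul_eq_mul]
        gcongr
        exact Set.inter_subset_left

theorem Potential.exists_restrict_volume_le (Φ : Potential n) {K : Set (E n)} (hK : IsCompact K) :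
    ∃ C : ℝ≥0∞, C ≠ (⊤ : ℝ≥0∞) ∧ (volume : Measure (E n)).restrict K ≤ C • Φ.μ := by
  obtain ⟨C, hC⟩ := (hK.image (Real.continuous_exp.comp Φ.continuous)).bddAbove
  refine ⟨ENNReal.ofReal C, ENNReal.ofReal_ne_top, Measure.le_iff.2 fun s hs => ?_⟩
  rw [Measure.restrict_apply hs, Measure.smul_apply, smul_eq_mul]
  refine le_trans ?_ (mul_le_mul_right (measure_mono (Set.inter_subset_left (t := K))) _)
  rw [Potential.μ, withDensity_apply _ (hs.inter hK.measurableSet),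
    ← lintegral_const_mul _ Φ.measurable_density, ← setLIntegral_one]
  refine setLIntegral_mono (Φ.measurable_density.const_mul _) fun x hx => ?_
  have h1 : Real.exp (Φ x) ≤ C := hC ⟨x, hx.2, rfl⟩
  rw [← ENNReal.ofReal_mul ((Real.exp_pos _).le.trans h1), ← ENNReal.ofReal_one]
  refine ENNReal.ofReal_le_ofReal ?_
  calc (1 : ℝ) = Real.exp (Φ x) * Real.exp (-Φ x) := by rw [← Real.exp_add]; simp
    _ ≤ C * Real.exp (-Φ x) := by gcongr

theorem eLpNorm_le_of_restrict_le {α F : Type*} [MeasurableSpace α] [NormedAddCommGroup F]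
    {μ ν : Measure α} {K : Set α} {C : ℝ≥0∞} (h : μ.restrict K ≤ C • ν) {f : α → F}
    (hf : Function.support f ⊆ K) :
    eLpNorm f 2 μ ≤ C ^ (1 / 2 : ℝ) * eLpNorm f 2 ν := by
  rw [← eLpNorm_restrict_eq_of_support_subset hf]
  refine (eLpNorm_mono_measure f h).trans_eq ?_
  rw [eLpNorm_smul_measure_of_ne_top (by simp)]
  simp

theorem MemLp.of_restrict_le {α F : Type*} [MeasurableSpace α] [NormedAddCommGroup F]
    {μ ν : Measure α} {K : Set α} {C : ℝ≥0∞} (hC : C ≠ (⊤ : ℝ≥0∞)) (h : μ.restrict K ≤ C • ν) {f : α → F}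
    (hm : StronglyMeasurable f) (hf : Function.support f ⊆ K) (hL : MemLp f 2 ν) : MemLp f 2 μ :=
  ⟨hm.aestronglyMeasurable, (eLpNorm_le_of_restrict_le h hf).trans_lt
    (ENNReal.mul_lt_top (ENNReal.rpow_lt_top_of_nonneg (by norm_num) hC) hL.2)⟩

/-! ### Mollification -/

open scoped Convolution

/-- The error is at most the translation modulus of `f` over the support of the mollifier, and that
support shrinks to a point. -/
theorem tendsto_eLpNorm_mollify_sub {F : Type*} [NormedAddCommGroup F] [NormedSpace ℝ F]
    [CompleteSpace F] {f : E n → F} (hf : LocallyIntegrable f) (hm : StronglyMeasurable f)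
    (hL : MemLp f 2 volume) {ρ : ℕ → ContDiffBump (0 : E n)}
    (hρ : Tendsto (fun k => (ρ k).rOut) atTop (𝓝 0)) :
    Tendsto (fun k => eLpNorm (fun x => ((ρ k).normed volume ⋆ f) x - f x) 2 volume) atTop
      (𝓝 0) := by
  rw [ENNReal.tendsto_nhds_zero]
  intro ε hε
  have h1 := (ENNReal.tendsto_nhds_zero.1 (tendsto_eLpNorm_translate_sub hL)) ε hε
  obtain ⟨δ, hδ, h2⟩ := Metric.eventually_nhds_iff.1 h1
  filter_upwards [hρ.eventually (gt_mem_nhds hδ)] with k hk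
  have h3 : eLpNorm (fun x => ((ρ k).normed volume ⋆ f) x - f x) 2 volume ^ 2 ≤ ε ^ 2 := by
    rw [eLpNorm_two_sq]
    refine lintegral_mollify_sub_le (ρ k) hf hm fun t ht => ?_
    rw [← eLpNorm_two_sq volume fun x => f (x - t) - f x]
    gcongr
    exact h2 (by simpa using ht.trans hk)
  exact (ENNReal.pow_le_pow_left_iff two_ne_zero).1 h3

/-- The derivative falls on the mollifier, and `t ↦ r (x - t)` is itself a test function. The sign
from the chain rule cancels the one in the weak gradient. -/
theorem formGrad_mollify {u : E n → ℂ} {g : E n → EuclideanSpace ℂ (Fin n)}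
    (h : IsWeakGradient u g) (hu : LocallyIntegrable u) (hg : LocallyIntegrable g)
    (ρ : ContDiffBump (0 : E n)) :
    formGrad (ρ.normed volume ⋆ u) = ρ.normed volume ⋆ g := by
  set r : E n → ℝ := ρ.normed volume with hr
  have hrs : ContDiff ℝ ∞ r := ρ.contDiff_normed
  have hrc : HasCompactSupport r := ρ.hasCompactSupport_normed
  funext x
  ext j
  set e : E n := EuclideanSpace.single j (1 : ℝ)
  have hflip : (r ⋆ u : E n → ℂ) =
      MeasureTheory.convolution u r (ContinuousLinearMap.lsmul ℝ ℝ).flip volume :=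
    (convolution_flip _).symm
  have hder := hrc.hasFDerivAt_convolution_right (ContinuousLinearMap.lsmul ℝ ℝ).flip hu
    (hrs.of_le (by simp)) x
  rw [← hflip] at hder
  change fderiv ℝ (r ⋆ u : E n → ℂ) x e = _
  rw [hder.fderiv, convolution_precompR_apply _ hu (hrc.fderiv (𝕜 := ℝ))
    (hrs.continuous_fderiv (by simp))]
  have hψ : ContDiff ℝ ∞ fun t => r (x - t) := hrs.comp (contDiff_const.sub contDiff_id)
  have hψc : HasCompactSupport fun t => r (x - t) := hrc.comp_homeomorph (Homeomorph.subLeft x)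
  have hψd : ∀ t, fderiv ℝ (fun t => r (x - t)) t e = - fderiv ℝ r (x - t) e := by
    intro t
    have h1 : HasFDerivAt (fun t : E n => x - t) (-ContinuousLinearMap.id ℝ (E n)) t := by
      simpa using (hasFDerivAt_id t).const_sub x
    have h2 := ((hrs.contDiffAt (x := x - t)).differentiableAt (by simp)).hasFDerivAt.comp t h1
    change fderiv ℝ (r ∘ fun t => x - t) t e = _
    rw [h2.fderiv]
    simp
  have hw := h j _ hψ hψc
  simp only [e] at hψd
  simp only [hψd, neg_smul, integral_neg, neg_inj] at hw
  change ∫ t, fderiv ℝ r (x - t) e • u t = _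
  rw [hw, convolution_eq_swap]
  have hi : Integrable fun t => r (x - t) • g t :=
    hg.integrable_smul_left_of_hasCompactSupport hψ.continuous hψc
  exact (EuclideanSpace.proj (𝕜 := ℂ) j).integral_comp_comm hi

/-! ### Test functions are dense in `H¹(μ)` -/

/-- The element of `H¹(μ)` given by a function and its weak gradient. -/
def H1.mk {Φ : Potential n} {u : E n → ℂ} {g : E n → EuclideanSpace ℂ (Fin n)}
    (hu : MemLp u 2 Φ.μ) (hg : MemLp g 2 Φ.μ) (h : IsWeakGradient u g) : H1 Φ :=
  ⟨WithLp.toLp 2 (hu.toLp u, hg.toLp g),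
    h.congr (Φ.volume_ac.ae_eq hu.coeFn_toLp) (Φ.volume_ac.ae_eq hg.coeFn_toLp)⟩

theorem H1.embedding_mk {Φ : Potential n} {u : E n → ℂ} {g : E n → EuclideanSpace ℂ (Fin n)}
    (hu : MemLp u 2 Φ.μ) (hg : MemLp g 2 Φ.μ) (h : IsWeakGradient u g) :
    (H1.embedding Φ (H1.mk hu hg h) : E n → ℂ) =ᵐ[Φ.μ] u :=
  hu.coeFn_toLp

theorem H1.d_mk {Φ : Potential n} {u : E n → ℂ} {g : E n → EuclideanSpace ℂ (Fin n)}
    (hu : MemLp u 2 Φ.μ) (hg : MemLp g 2 Φ.μ) (h : IsWeakGradient u g) :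
    (H1.d Φ (H1.mk hu hg h) : E n → EuclideanSpace ℂ (Fin n)) =ᵐ[Φ.μ] g :=
  hg.coeFn_toLp

theorem H1.tendsto_mk {Φ : Potential n} {ι : Type*} {l : Filter ι} {u : ι → E n → ℂ}
    {g : ι → E n → EuclideanSpace ℂ (Fin n)} (hu : ∀ k, MemLp (u k) 2 Φ.μ)
    (hg : ∀ k, MemLp (g k) 2 Φ.μ) (h : ∀ k, IsWeakGradient (u k) (g k))
    (w : H1 Φ) {u' : E n → ℂ} {g' : E n → EuclideanSpace ℂ (Fin n)}
    (hu' : (w.1.fst : E n → ℂ) =ᵐ[Φ.μ] u')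
    (hg' : (w.1.snd : E n → EuclideanSpace ℂ (Fin n)) =ᵐ[Φ.μ] g')
    (h1 : Tendsto (fun k => eLpNorm (fun x => u k x - u' x) 2 Φ.μ) l (𝓝 0))
    (h2 : Tendsto (fun k => eLpNorm (fun x => g k x - g' x) 2 Φ.μ) l (𝓝 0)) :
    Tendsto (fun k => H1.mk (hu k) (hg k) (h k)) l (𝓝 w) := by
  rw [tendsto_subtype_rng]
  have e1 : Tendsto (fun k => (hu k).toLp (u k)) l (𝓝 w.1.fst) := by
    rw [tendsto_iff_edist_tendsto_0]
    refine h1.congr fun k => ?_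
    rw [Lp.edist_def]
    refine eLpNorm_congr_ae ?_
    filter_upwards [hu', (hu k).coeFn_toLp] with x hx hx'
    rw [Pi.sub_apply, hx, hx']
  have e2 : Tendsto (fun k => (hg k).toLp (g k)) l (𝓝 w.1.snd) := by
    rw [tendsto_iff_edist_tendsto_0]
    refine h2.congr fun k => ?_
    rw [Lp.edist_def]
    refine eLpNorm_congr_ae ?_
    filter_upwards [hg', (hg k).coeFn_toLp] with x hx hx'
    rw [Pi.sub_apply, hx, hx']
  exact ((WithLp.prod_continuous_toLp 2 (L2 Φ) (L2Form Φ)).tendsto (w.1.fst, w.1.snd)).comp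
    (e1.prodMk_nhds e2)

/-- The test functions in `H¹(μ)`. -/
def H1.test (Φ : Potential n) : Set (H1 Φ) :=
  {w | ∃ φ : E n → ℂ, ContDiff ℝ ∞ φ ∧ HasCompactSupport φ ∧
    (H1.embedding Φ w : E n → ℂ) =ᵐ[Φ.μ] φ ∧
    (H1.d Φ w : E n → EuclideanSpace ℂ (Fin n)) =ᵐ[Φ.μ] formGrad φ}

open scoped Pointwise in
-- Mollifiers of radius at most `1` keep all supports in the fixed compact set `K'`, so Lebesgue
-- `L²` convergence of `u` and `g` passes to `μ`.
theorem H1.mem_closure_test_of_support_subset {Φ : Potential n} {u : E n → ℂ}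
    {g : E n → EuclideanSpace ℂ (Fin n)} (hu : MemLp u 2 Φ.μ) (hg : MemLp g 2 Φ.μ)
    (h : IsWeakGradient u g) (hum : StronglyMeasurable u) (hgm : StronglyMeasurable g)
    {K : Set (E n)} (hK : IsCompact K) (huK : Function.support u ⊆ K)
    (hgK : Function.support g ⊆ K) : H1.mk hu hg h ∈ closure (H1.test Φ) := by
  obtain ⟨C, hC, hCK⟩ := Φ.exists_restrict_volume_le hK
  have huV : MemLp u 2 volume := MemLp.of_restrict_le hC hCK hum huK hu
  have hgV : MemLp g 2 volume := MemLp.of_restrict_le hC hCK hgm hgK hg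
  have hul : LocallyIntegrable u := huV.locallyIntegrable (by norm_num)
  have hgl : LocallyIntegrable g := hgV.locallyIntegrable (by norm_num)
  let K' : Set (E n) := Metric.closedBall (0 : E n) 1 + K
  have hK' : IsCompact K' := (isCompact_closedBall (0 : E n) 1).add hK
  have hKK' : K ⊆ K' := fun x hx => ⟨0, by simp, x, hx, by simp⟩
  let ρ : ℕ → ContDiffBump (0 : E n) := fun k =>
    ⟨1 / ((k : ℝ) + 1) / 2, 1 / ((k : ℝ) + 1), by positivity, by
      have : 0 < 1 / ((k : ℝ) + 1) := by positivity
      linarith⟩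
  have hρ : Tendsto (fun k => (ρ k).rOut) atTop (𝓝 0) := tendsto_one_div_add_atTop_nhds_zero_nat
  have hρ1 : ∀ k, (ρ k).rOut ≤ 1 := fun k => by
    simp only [ρ]
    rw [div_le_one (by positivity)]
    linarith [(Nat.cast_nonneg k : (0 : ℝ) ≤ k)]
  have hsupp : ∀ {F : Type} [NormedAddCommGroup F] [NormedSpace ℝ F] (f : E n → F) (k : ℕ),
      Function.support f ⊆ K → Function.support ((ρ k).normed volume ⋆ f : E n → F) ⊆ K' := by
    intro F _ _ f k hf
    refine (support_convolution_subset _).trans (Set.add_subset_add ?_ hf)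
    rw [ContDiffBump.support_normed_eq]
    exact Metric.ball_subset_closedBall.trans (Metric.closedBall_subset_closedBall (hρ1 k))
  obtain ⟨C', hC', hCK'⟩ := Φ.exists_restrict_μ_le hK'
  have hconv : ∀ {F : Type} [NormedAddCommGroup F] [NormedSpace ℝ F] [CompleteSpace F]
      (f : E n → F), LocallyIntegrable f → StronglyMeasurable f → MemLp f 2 volume →
      Function.support f ⊆ K →
      Tendsto (fun k => eLpNorm (fun x => ((ρ k).normed volume ⋆ f) x - f x) 2 Φ.μ) atTop
        (𝓝 0) := by
    intro F _ _ _ f hfl hfm hfV hfK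
    have h1 := ENNReal.Tendsto.const_mul (a := C' ^ (1 / 2 : ℝ))
      (tendsto_eLpNorm_mollify_sub hfl hfm hfV hρ)
      (Or.inr (ENNReal.rpow_ne_top_of_nonneg (by norm_num) hC'))
    rw [mul_zero] at h1
    refine tendsto_of_tendsto_of_tendsto_of_le_of_le tendsto_const_nhds h1
      (fun _ => bot_le) fun k => ?_
    refine eLpNorm_le_of_restrict_le hCK' ((Function.support_sub _ _).trans ?_)
    exact Set.union_subset (hsupp f k hfK) (hfK.trans hKK')
  have hcs : ∀ k, HasCompactSupport ((ρ k).normed volume ⋆ u : E n → ℂ) := fun k =>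
    HasCompactSupport.intro hK' fun x hx =>
      Function.notMem_support.1 fun h' => hx (hsupp u k huK h')
  have hsm : ∀ k, ContDiff ℝ ∞ ((ρ k).normed volume ⋆ u : E n → ℂ) := fun k =>
    (ρ k).hasCompactSupport_normed.contDiff_convolution_left _ (ρ k).contDiff_normed hul
  refine mem_closure_of_tendsto (b := atTop) (f := fun k => H1.mk
    ((hsm k).continuous.memLp_of_hasCompactSupport (hcs k))
    ((continuous_formGrad (hsm k)).memLp_of_hasCompactSupport (hasCompactSupport_formGrad (hcs k)))
    (isWeakGradient_formGrad (hsm k))) ?_ (Eventually.of_forall fun k => ?_)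
  · refine H1.tendsto_mk _ _ _ _ hu.coeFn_toLp hg.coeFn_toLp (hconv u hul hum huV huK) ?_
    simp only [fun k => formGrad_mollify h hul hgl (ρ k)]
    exact hconv g hgl hgm hgV hgK
  · exact ⟨_, hsm k, hcs k, H1.embedding_mk _ _ _, H1.d_mk _ _ _⟩

/-- Dominated convergence with majorant `|f|²`, since `|χ k - 1| ≤ 1`. -/
theorem tendsto_eLpNorm_smul_sub {α F : Type*} [MeasurableSpace α] {μ : Measure α}
    [NormedAddCommGroup F] [NormedSpace ℝ F] {f : α → F} (hf : MemLp f 2 μ) {χ : ℕ → α → ℝ}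
    (hm : ∀ k, StronglyMeasurable (χ k)) (h0 : ∀ k x, 0 ≤ χ k x) (h1 : ∀ k x, χ k x ≤ 1)
    (hlim : ∀ x, ∀ᶠ k in atTop, χ k x = 1) :
    Tendsto (fun k => eLpNorm (fun x => χ k x • f x - f x) 2 μ) atTop (𝓝 0) := by
  have hsq : Tendsto (fun k => eLpNorm (fun x => χ k x • f x - f x) 2 μ ^ 2) atTop (𝓝 0) := by
    simp only [eLpNorm_two_sq]
    have := tendsto_lintegral_of_dominated_convergence' (μ := μ)
      (F := fun k x => ‖χ k x • f x - f x‖ₑ ^ 2) (f := fun _ => 0) (fun x => ‖f x‖ₑ ^ 2)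
      (fun k => (((hm k).aestronglyMeasurable.smul hf.1).sub hf.1).enorm.pow_const 2)
      (fun k => Eventually.of_forall fun x => ?_) ?_ (Eventually.of_forall fun x => ?_)
    · simpa using this
    · have : χ k x • f x - f x = (χ k x - 1) • f x := by rw [sub_smul, one_smul]
      simp only [this, enorm_smul]
      have h2 : ‖χ k x - 1‖ₑ ≤ 1 := by
        rw [← enorm_one (G := ℝ), enorm_le_iff_norm_le, norm_one, Real.norm_eq_abs, abs_le]
        constructor <;> linarith [h0 k x, h1 k x]
      calc (‖χ k x - 1‖ₑ * ‖f x‖ₑ) ^ 2 ≤ (1 * ‖f x‖ₑ) ^ 2 := by gcongr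
        _ = ‖f x‖ₑ ^ 2 := by rw [one_mul]
    · rw [← eLpNorm_two_sq]
      exact ENNReal.pow_ne_top hf.2.ne
    · refine tendsto_const_nhds.congr' ?_
      filter_upwards [hlim x] with k hk
      simp [hk]
  have h3 := (ENNReal.continuous_rpow_const (y := 1 / 2)).tendsto 0 |>.comp hsq
  rw [ENNReal.zero_rpow_of_pos (by norm_num)] at h3
  refine h3.congr fun k => ?_
  simp only [Function.comp_apply]
  rw [← ENNReal.rpow_natCast, ← ENNReal.rpow_mul]
  simp

/-- Cutoff functions exhausting `ℝⁿ`, with gradients tending to zero. -/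
theorem exists_cutoffs (n : ℕ) : ∃ (χ : ℕ → E n → ℝ) (c : ℕ → ℝ),
    (∀ k, ContDiff ℝ ∞ (χ k)) ∧ (∀ k, HasCompactSupport (χ k)) ∧ (∀ k x, 0 ≤ χ k x) ∧
    (∀ k x, χ k x ≤ 1) ∧ (∀ x, ∀ᶠ k in atTop, χ k x = 1) ∧ Tendsto c atTop (𝓝 0) ∧
    ∀ k x, ‖realGrad (χ k) x‖ ≤ c k := by
  let χ₀ : ContDiffBump (0 : E n) := ⟨1, 2, by norm_num, by norm_num⟩
  let c : ℕ → ℝ := fun k => 1 / ((k : ℝ) + 1)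
  have hcpos : ∀ k, 0 < c k := fun k => by positivity
  have hc0 : Tendsto c atTop (𝓝 0) := tendsto_one_div_add_atTop_nhds_zero_nat
  -- Dilating one fixed bump puts the factor `c k` on its gradient.
  let χ : ℕ → E n → ℝ := fun k x => χ₀ (c k • x)
  have hgrad : ∀ k x, realGrad (χ k) x = c k • realGrad χ₀ (c k • x) := by
    intro k x
    have h1 : HasFDerivAt (fun x : E n => c k • x) (c k • ContinuousLinearMap.id ℝ (E n)) x :=
      (hasFDerivAt_id x).const_smul (c k)
    have h2 := ((χ₀.contDiff (n := 1)).contDiffAt (x := c k • x) |>.differentiableAt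
      (by simp)).hasFDerivAt.comp x h1
    have h3 : fderiv ℝ (χ k) x = _ := h2.fderiv
    ext j
    simp [realGrad, h3]
  obtain ⟨M, hM⟩ := (continuous_realGrad χ₀.contDiff).bounded_above_of_compact_support
    (hasCompactSupport_realGrad χ₀.hasCompactSupport)
  refine ⟨χ, fun k => c k * M, fun k => χ₀.contDiff.comp (contDiff_id.const_smul (c k)),
    fun k => χ₀.hasCompactSupport.comp_smul (hcpos k).ne', fun _ _ => χ₀.nonneg,
    fun _ _ => χ₀.le_one, fun x => ?_, by simpa using hc0.mul_const M, fun k x => ?_⟩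
  · have h1 : Tendsto (fun k => ‖c k • x‖) atTop (𝓝 0) := by
      simpa using (hc0.smul_const x).norm
    filter_upwards [h1.eventually (gt_mem_nhds one_pos)] with k hk
    exact χ₀.one_of_mem_closedBall (by simpa using hk.le)
  · rw [hgrad, norm_smul, Real.norm_of_nonneg (hcpos k).le]
    exact mul_le_mul_of_nonneg_left (hM _) (hcpos k).le

/-- The test functions are dense in `H¹(μ)`. -/
theorem H1.dense_test (Φ : Potential n) : Dense (H1.test Φ) := by
  intro w
  -- Two limits: cutoffs reduce to compact support, and mollification then reduces to test
  -- functions.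
  rw [← closure_closure]
  obtain ⟨χ, c, hχ, hχc, hχ0, hχ1, hlim, hc0, hcb⟩ := exists_cutoffs n
  obtain ⟨u, hue⟩ : ∃ u : E n → ℂ, u = (w.1.fst : E n → ℂ) := ⟨_, rfl⟩
  obtain ⟨g, hge⟩ : ∃ g : E n → EuclideanSpace ℂ (Fin n),
    g = (w.1.snd : E n → EuclideanSpace ℂ (Fin n)) := ⟨_, rfl⟩
  have hu : MemLp u 2 Φ.μ := hue ▸ Lp.memLp _
  have hg : MemLp g 2 Φ.μ := hge ▸ Lp.memLp _
  have hul : LocallyIntegrable u := hue ▸ locallyIntegrable_coeFn Φ _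
  have hgl : LocallyIntegrable g := hge ▸ locallyIntegrable_coeFn Φ _
  have hug : IsWeakGradient u g := by rw [hue, hge]; exact w.2
  have hum : StronglyMeasurable u := hue ▸ Lp.stronglyMeasurable _
  have hgm : StronglyMeasurable g := hge ▸ Lp.stronglyMeasurable _
  have hχm : ∀ k, StronglyMeasurable (χ k) := fun k => (hχ k).continuous.stronglyMeasurable
  have hvm : ∀ k, StronglyMeasurable fun x => χ k x • u x := fun k => (hχm k).smul hum
  have hgm' : ∀ k, StronglyMeasurable fun x => u x • realGrad (χ k) x := fun k =>
    hum.smul (continuous_realGrad (hχ k)).stronglyMeasurable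
  have hL1 : ∀ {F : Type} [NormedAddCommGroup F] [NormedSpace ℝ F] {f : E n → F},
      MemLp f 2 Φ.μ → ∀ k, MemLp (fun x => χ k x • f x) 2 Φ.μ := by
    intro F _ _ f hf k
    refine hf.of_le ((hχm k).aestronglyMeasurable.smul hf.1) (Eventually.of_forall fun x => ?_)
    rw [norm_smul, Real.norm_of_nonneg (hχ0 k x)]
    exact mul_le_of_le_one_left (norm_nonneg _) (hχ1 k x)
  have hbd : ∀ k x, ‖u x • realGrad (χ k) x‖ ≤ c k * ‖u x‖ := by
    intro k x
    rw [norm_smul, mul_comm]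
    exact mul_le_mul_of_nonneg_right (hcb k x) (norm_nonneg _)
  have hL2 : ∀ k, MemLp (fun x => u x • realGrad (χ k) x) 2 Φ.μ := fun k =>
    hu.of_le_mul (hgm' k).aestronglyMeasurable (Eventually.of_forall (hbd k))
  have hLG : ∀ k, MemLp (fun x => χ k x • g x + u x • realGrad (χ k) x) 2 Φ.μ := fun k =>
    (hL1 hg k).add (hL2 k)
  refine mem_closure_of_tendsto (b := atTop)
    (f := fun k => H1.mk (hL1 hu k) (hLG k) (hug.smul_smooth hul hgl (hχ k))) ?_
    (Eventually.of_forall fun k => ?_)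
  · refine H1.tendsto_mk _ _ _ w (u' := u) (g' := g) (by rw [hue]) (by rw [hge])
      (tendsto_eLpNorm_smul_sub hu hχm hχ0 hχ1 hlim) ?_
    have t1 := tendsto_eLpNorm_smul_sub hg hχm hχ0 hχ1 hlim
    have t2 : Tendsto (fun k => ENNReal.ofReal (c k) * eLpNorm u 2 Φ.μ) atTop (𝓝 0) := by
      have := ENNReal.Tendsto.mul_const (b := eLpNorm u 2 Φ.μ)
        (ENNReal.tendsto_ofReal hc0) (Or.inr hu.2.ne)
      simpa using this
    have t3 := t1.add t2
    rw [add_zero] at t3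
    refine tendsto_of_tendsto_of_tendsto_of_le_of_le tendsto_const_nhds t3
      (fun _ => bot_le) fun k => ?_
    have he : (fun x => χ k x • g x + u x • realGrad (χ k) x - g x) =
        (fun x => χ k x • g x - g x) + fun x => u x • realGrad (χ k) x := by
      funext x
      simp only [Pi.add_apply]
      abel
    change eLpNorm (fun x => χ k x • g x + u x • realGrad (χ k) x - g x) 2 Φ.μ ≤ _
    rw [he]
    refine (eLpNorm_add_le ((hL1 hg k).1.sub hg.1) (hL2 k).1 (by norm_num)).trans ?_
    exact add_le_add le_rfl
      (eLpNorm_le_mul_eLpNorm_of_ae_le_mul (Eventually.of_forall (hbd k)) 2)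
  · refine H1.mem_closure_test_of_support_subset _ _ _ (hvm k) (((hχm k).smul hgm).add (hgm' k))
      (K := tsupport (χ k)) (hχc k) (fun x hx => ?_) (fun x hx => ?_)
    · by_contra hxs
      exact hx (by simp [image_eq_zero_of_notMem_tsupport hxs])
    · by_contra hxs
      have h2 : fderiv ℝ (χ k) x = 0 := by
        by_contra h0
        exact hxs (support_fderiv_subset ℝ h0)
      have h3 : realGrad (χ k) x = 0 := by
        ext j; simp [realGrad, h2]
      exact hx (by simp [image_eq_zero_of_notMem_tsupport hxs, h3])

/-! ### The weighted estimate and smallness at infinity. -/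

/-- The partial derivative `∂ⱼf`. -/
def partialDeriv (j : Fin n) (f : E n → ℝ) (x : E n) : ℝ :=
  fderiv ℝ f x (EuclideanSpace.single j 1)

theorem contDiff_partialDeriv {f : E n → ℝ} {m k : WithTop ℕ∞} (hf : ContDiff ℝ k f)
    (h : m + 1 ≤ k) (j : Fin n) : ContDiff ℝ m (partialDeriv j f) :=
  (hf.fderiv_right h).clm_apply contDiff_const

theorem norm_gradient_sq (f : E n → ℝ) (x : E n) :
    ‖gradient f x‖ ^ 2 = ∑ j, partialDeriv j f x ^ 2 := by
  rw [EuclideanSpace.norm_sq_eq]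
  refine Finset.sum_congr rfl fun j _ => ?_
  have h : inner ℝ (gradient f x) (EuclideanSpace.single j (1 : ℝ)) = partialDeriv j f x :=
    inner_gradient_left
  rw [EuclideanSpace.inner_single_right] at h
  rw [← h]
  simp

theorem laplacian_eq_sum {f : E n → ℝ} (hf : ContDiff ℝ 2 f) (x : E n) :
    Laplacian.laplacian f x = ∑ j, partialDeriv j (partialDeriv j f) x := by
  rw [InnerProductSpace.laplacian_eq_iteratedFDeriv_orthonormalBasis f
    (EuclideanSpace.basisFun (Fin n) ℝ)]
  refine Finset.sum_congr rfl fun j _ => ?_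
  rw [iteratedFDeriv_two_apply]
  have hd : DifferentiableAt ℝ (fderiv ℝ f) x :=
    ((hf.fderiv_right (m := 1) (by norm_num)).differentiable (by norm_num)).differentiableAt
  have h2 : partialDeriv j (partialDeriv j f) x =
      fderiv ℝ (fderiv ℝ f) x (EuclideanSpace.single j 1) (EuclideanSpace.single j 1) := by
    have h1 := (hd.hasFDerivAt.clm_apply
      (hasFDerivAt_const (EuclideanSpace.single j (1 : ℝ)) x)).fderiv
    unfold partialDeriv
    rw [h1]
    simp
  simp [h2]

theorem fderiv_norm_sq_apply {φ : E n → ℂ} (hφ : ContDiff ℝ ∞ φ) (x e : E n) :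
    fderiv ℝ (fun x => ‖φ x‖ ^ 2) x e = 2 * inner ℝ (φ x) (fderiv ℝ φ x e) := by
  have h1 := (hφ.contDiffAt.differentiableAt (x := x) (by simp)).hasFDerivAt.norm_sq
  rw [h1.fderiv]
  simp
  ring

/-- Integration by parts differentiates `∂ⱼΦ e^{-Φ}` once; `Φ ∈ C²` provides exactly this
regularity. -/
theorem Potential.contDiff_partialDeriv_mul_exp (Φ : Potential n) (j : Fin n) :
    ContDiff ℝ 1 fun x => partialDeriv j Φ x * Real.exp (-Φ x) :=
  (contDiff_partialDeriv Φ.contDiff (by norm_num) j).mul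
    (Real.contDiff_exp.comp (Φ.contDiff.of_le (by norm_num)).neg)

theorem Potential.partialDeriv_mul_exp (Φ : Potential n) (j : Fin n) (x : E n) :
    fderiv ℝ (fun x => partialDeriv j Φ x * Real.exp (-Φ x)) x (EuclideanSpace.single j 1) =
      (partialDeriv j (partialDeriv j Φ) x - partialDeriv j Φ x ^ 2) * Real.exp (-Φ x) := by
  have hD : ContDiff ℝ 1 (partialDeriv j Φ) := contDiff_partialDeriv Φ.contDiff (by norm_num) j
  have hΦd : HasFDerivAt Φ (fderiv ℝ Φ x) x :=
    (Φ.contDiff.differentiable (by norm_num)).differentiableAt.hasFDerivAt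
  have h1 := ((hD.differentiable (by norm_num)).differentiableAt (x := x)).hasFDerivAt.mul
    hΦd.neg.exp
  have h2 : fderiv ℝ (fun x => partialDeriv j Φ x * Real.exp (-Φ x)) x = _ := h1.fderiv
  rw [h2]
  simp only [add_apply, smul_apply, neg_apply, smul_eq_mul]
  change partialDeriv j Φ x * (Real.exp (-Φ x) * -partialDeriv j Φ x) +
    Real.exp (-Φ x) * partialDeriv j (partialDeriv j Φ) x = _
  ring

/-- To be read with `E = e^{-Φ}`, `p = ∂ⱼΦ`, `q = ∂ⱼ²Φ`, `N = |φ|`, `d = |∂ⱼφ|`, `I = Re(φ̄ ∂ⱼφ)`.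
The second summand is then `∂ⱼ(|φ|² ∂ⱼΦ e^{-Φ})`. The `q` terms cancel, and completing the square
bounds `-(1-θ)p²N² + 2Ip` by `(1-θ)⁻¹d²`. -/
theorem weighted_young {θ E p q I N d : ℝ} (hθ : θ < 1) (hE : 0 ≤ E) (hI : |I| ≤ N * d) :
    E * ((θ * p ^ 2 - q) * N ^ 2) + (N ^ 2 * ((q - p ^ 2) * E) + 2 * I * (p * E)) ≤
      (1 - θ)⁻¹ * (E * d ^ 2) := by
  have hθ' : 0 < 1 - θ := by linarith
  have h1 : I * p ≤ N * d * |p| :=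
    (le_abs_self _).trans ((abs_mul I p).trans_le (mul_le_mul_of_nonneg_right hI (abs_nonneg p)))
  have h3 : 0 ≤ (1 - θ)⁻¹ * ((1 - θ) * (|p| * N) - d) ^ 2 := by positivity
  have h4 : (1 - θ)⁻¹ * ((1 - θ) * (|p| * N) - d) ^ 2 =
      (1 - θ) * (|p| ^ 2 * N ^ 2) + (1 - θ)⁻¹ * d ^ 2 - 2 * (N * d * |p|) := by
    field_simp
    ring
  rw [h4, sq_abs] at h3
  have h5 : 0 ≤ E * ((1 - θ) * (p ^ 2 * N ^ 2) + (1 - θ)⁻¹ * d ^ 2 - 2 * (I * p)) :=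
    mul_nonneg hE (by linarith)
  linarith

/-- The one-dimensional weighted estimate: integrate `∂ⱼ(|φ|² ∂ⱼΦ e^{-Φ})`. -/
theorem integral_partialDeriv_weight_le (Φ : Potential n) {θ : ℝ} (hθ : θ < 1) {φ : E n → ℂ}
    (hφ : ContDiff ℝ ∞ φ) (hc : HasCompactSupport φ) (j : Fin n) :
    ∫ x, (θ * partialDeriv j Φ x ^ 2 - partialDeriv j (partialDeriv j Φ) x) * ‖φ x‖ ^ 2 ∂Φ.μ ≤
      (1 - θ)⁻¹ * ∫ x, ‖fderiv ℝ φ x (EuclideanSpace.single j 1)‖ ^ 2 ∂Φ.μ := by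
  obtain ⟨e, he⟩ : ∃ e : E n, e = EuclideanSpace.single j (1 : ℝ) := ⟨_, rfl⟩
  obtain ⟨G, hGe⟩ : ∃ G : E n → ℝ, G = fun x => partialDeriv j Φ x * Real.exp (-Φ x) := ⟨_, rfl⟩
  have hG : ContDiff ℝ 1 G := hGe ▸ Φ.contDiff_partialDeriv_mul_exp j
  have hGd : ∀ x, fderiv ℝ G x e =
      (partialDeriv j (partialDeriv j Φ) x - partialDeriv j Φ x ^ 2) * Real.exp (-Φ x) :=
    fun x => by rw [hGe, he]; exact Φ.partialDeriv_mul_exp j x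
  obtain ⟨f, hfe⟩ : ∃ f : E n → ℝ, f = fun x => ‖φ x‖ ^ 2 := ⟨_, rfl⟩
  have hf : ContDiff ℝ ∞ f := hfe ▸ hφ.norm_sq ℝ
  have hfc : HasCompactSupport f :=
    hc.mono fun x hx h0 => hx (by rw [hfe]; simp [h0])
  have hfd : ∀ x, fderiv ℝ f x e = 2 * inner ℝ (φ x) (fderiv ℝ φ x e) :=
    fun x => hfe ▸ fderiv_norm_sq_apply hφ x e
  have hfdc : Continuous fun x => fderiv ℝ f x e := continuous_fderiv_test hf e
  have hGdc : Continuous fun x => fderiv ℝ G x e :=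
    (hG.continuous_fderiv (by norm_num)).clm_apply continuous_const
  have i3 : Integrable fun x => fderiv ℝ f x e * G x :=
    (hfdc.mul hG.continuous).integrable_of_hasCompactSupport
      (hasCompactSupport_fderiv_test hfc e).mul_right
  have i4 : Integrable fun x => f x * fderiv ℝ G x e :=
    (hf.continuous.mul hGdc).integrable_of_hasCompactSupport hfc.mul_right
  have key := integral_mul_fderiv_eq_neg_fderiv_mul_of_integrable (f := f) (g := G) (v := e)
    (μ := (volume : Measure (E n))) i3 i4
    ((hf.continuous.mul hG.continuous).integrable_of_hasCompactSupport hfc.mul_right)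
    (fun x _ => hf.contDiffAt.differentiableAt (by simp))
    (fun x _ => hG.contDiffAt.differentiableAt (by norm_num))
  have hEc : Continuous fun x => Real.exp (-Φ x) := Real.continuous_exp.comp Φ.continuous.neg
  have hdc : HasCompactSupport fun x => ‖fderiv ℝ φ x e‖ ^ 2 :=
    (hasCompactSupport_fderiv_test hc e).mono fun x hx h0 => hx (by simp [h0])
  have hD : ContDiff ℝ 1 (partialDeriv j Φ) := contDiff_partialDeriv Φ.contDiff (by norm_num) j
  have hDD : Continuous (partialDeriv j (partialDeriv j Φ)) :=
    (contDiff_partialDeriv (m := 0) hD (by norm_num) j).continuous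
  have i1 : Integrable fun x => Real.exp (-Φ x) *
      ((θ * partialDeriv j Φ x ^ 2 - partialDeriv j (partialDeriv j Φ) x) * f x) :=
    Continuous.integrable_of_hasCompactSupport
      (hEc.mul ((((hD.continuous.pow 2).const_mul θ).sub hDD).mul hf.continuous))
      hfc.mul_left.mul_left
  have i2 : Integrable fun x => (1 - θ)⁻¹ * (Real.exp (-Φ x) * ‖fderiv ℝ φ x e‖ ^ 2) :=
    (Continuous.integrable_of_hasCompactSupport
      (hEc.mul ((continuous_fderiv_test hφ e).norm.pow 2)) hdc.mul_left).const_mul _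
  have i5 : Integrable fun x => f x * fderiv ℝ G x e + fderiv ℝ f x e * G x := i4.add i3
  -- Adding this null term to the left integrand reduces the claim to a pointwise inequality.
  have hz : ∫ x, (f x * fderiv ℝ G x e + fderiv ℝ f x e * G x) = 0 := by
    rw [integral_add i4 i3, key, neg_add_cancel]
  rw [Φ.integral_μ, Φ.integral_μ, ← integral_const_mul, ← he]
  simp only [smul_eq_mul]
  calc ∫ x, Real.exp (-Φ x) *
        ((θ * partialDeriv j Φ x ^ 2 - partialDeriv j (partialDeriv j Φ) x) * ‖φ x‖ ^ 2)
      = ∫ x, (Real.exp (-Φ x) *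
        ((θ * partialDeriv j Φ x ^ 2 - partialDeriv j (partialDeriv j Φ) x) * f x) +
        (f x * fderiv ℝ G x e + fderiv ℝ f x e * G x)) := by
        rw [integral_add i1 i5, hz, add_zero, hfe]
    _ ≤ _ := by
        refine integral_mono (i1.add i5) i2 fun x => ?_
        simp only [hGd, hfd]
        rw [hfe, hGe]
        exact weighted_young hθ (Real.exp_pos _).le (abs_real_inner_le_norm _ _)

/-- The weight `θ|Φ'|² - ΔΦ`. -/
def Potential.weight (Φ : Potential n) (θ : ℝ) (x : E n) : ℝ :=
  θ * ‖gradient Φ x‖ ^ 2 - Laplacian.laplacian (⇑Φ) x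

theorem Potential.weight_eq_sum (Φ : Potential n) (θ : ℝ) (x : E n) :
    Φ.weight θ x =
      ∑ j, (θ * partialDeriv j Φ x ^ 2 - partialDeriv j (partialDeriv j Φ) x) := by
  rw [Potential.weight, norm_gradient_sq, laplacian_eq_sum Φ.contDiff, Finset.sum_sub_distrib,
    Finset.mul_sum]

theorem Potential.continuous_weight_summand (Φ : Potential n) (θ : ℝ) (j : Fin n) :
    Continuous fun x => θ * partialDeriv j Φ x ^ 2 - partialDeriv j (partialDeriv j Φ) x := by
  have hD : ContDiff ℝ 1 (partialDeriv j Φ) := contDiff_partialDeriv Φ.contDiff (by norm_num) j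
  exact ((hD.continuous.pow 2).const_mul θ).sub
    (contDiff_partialDeriv (m := 0) hD (by norm_num) j).continuous

theorem Potential.continuous_weight (Φ : Potential n) (θ : ℝ) : Continuous (Φ.weight θ) := by
  simp only [funext (Φ.weight_eq_sum θ)]
  exact continuous_finsetSum _ fun j _ => Φ.continuous_weight_summand θ j

theorem integral_weight_le (Φ : Potential n) {θ : ℝ} (hθ : θ < 1) {φ : E n → ℂ}
    (hφ : ContDiff ℝ ∞ φ) (hc : HasCompactSupport φ) :
    ∫ x, Φ.weight θ x * ‖φ x‖ ^ 2 ∂Φ.μ ≤ (1 - θ)⁻¹ * ∫ x, ‖formGrad φ x‖ ^ 2 ∂Φ.μ := by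
  have hsq : HasCompactSupport fun x => ‖φ x‖ ^ 2 := hc.mono fun x hx h0 => hx (by simp [h0])
  simp only [Φ.weight_eq_sum, Finset.sum_mul, EuclideanSpace.norm_sq_eq, formGrad]
  rw [integral_finsetSum _ fun j _ => ?_, integral_finsetSum _ fun j _ => ?_, Finset.mul_sum]
  · exact Finset.sum_le_sum fun j _ => integral_partialDeriv_weight_le Φ hθ hφ hc j
  · exact ((continuous_fderiv_test hφ _).norm.pow 2).integrable_of_hasCompactSupport
      ((hasCompactSupport_fderiv_test hc (EuclideanSpace.single j (1 : ℝ))).mono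
        fun x hx h0 => hx (by simp [h0]))
  · exact ((Φ.continuous_weight_summand θ j).mul
      (hφ.continuous.norm.pow 2)).integrable_of_hasCompactSupport hsq.mul_left

theorem norm_sq_eq_integral {α F : Type*} [MeasurableSpace α] {μ : Measure α}
    [NormedAddCommGroup F] [InnerProductSpace ℂ F] {f : α → F} {u : Lp F 2 μ} (h : u =ᵐ[μ] f) :
    ‖u‖ ^ 2 = ∫ x, ‖f x‖ ^ 2 ∂μ := by
  have h1 : ((‖u‖ ^ 2 : ℝ) : ℂ) = ((∫ x, ‖f x‖ ^ 2 ∂μ : ℝ) : ℂ) := by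
    rw [← integral_complex_ofReal]
    push_cast
    have h0 := inner_self_eq_norm_sq_to_K (𝕜 := ℂ) u
    rw [L2.inner_def] at h0
    refine h0.symm.trans (integral_congr_ae (h.mono fun x hx => ?_))
    simp only [hx, inner_self_eq_norm_sq_to_K]
    rfl
  exact_mod_cast h1

theorem H1.norm_sq_eq (Φ : Potential n) (w : H1 Φ) :
    ‖w‖ ^ 2 = ‖H1.embedding Φ w‖ ^ 2 + ‖H1.d Φ w‖ ^ 2 := by
  rw [← inner_self_eq_norm_sq (𝕜 := ℂ), ← inner_self_eq_norm_sq (𝕜 := ℂ) (H1.embedding Φ w),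
    ← inner_self_eq_norm_sq (𝕜 := ℂ) (H1.d Φ w), H1.inner_eq, map_add]

/-- The mass of test functions in the unit ball of `H¹(μ)` is uniformly small near infinity. -/
theorem exists_tail_le (Φ : Potential n) {θ : ℝ} (hθ : θ < 1)
    (hlim : Tendsto (Φ.weight θ) (cocompact (E n)) atTop) {ε : ℝ} (hε : 0 < ε) :
    ∃ R : ℝ, 0 < R ∧ ∀ w ∈ H1.test Φ, ∀ χ : E n → ℝ, Measurable χ → (∀ x, 0 ≤ χ x) →
      (∀ x, χ x ≤ 1) → (∀ x, ‖x‖ ≤ R → χ x = 0) →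
      ∫ x, ‖χ x • (H1.embedding Φ w : E n → ℂ) x‖ ^ 2 ∂Φ.μ ≤ ε * ‖w‖ ^ 2 := by
  -- The weight may be negative on a compact set; the shift `c` makes it nonnegative everywhere.
  obtain ⟨c, hc0, hc⟩ : ∃ c : ℝ, 0 ≤ c ∧ ∀ x, 0 ≤ Φ.weight θ x + c := by
    obtain ⟨K, hK, hKw⟩ := mem_cocompact.1 (hlim.eventually_ge_atTop 0)
    obtain ⟨b, hb⟩ := (hK.image (Φ.continuous_weight θ)).bddBelow
    refine ⟨|b|, abs_nonneg _, fun x => ?_⟩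
    by_cases hx : x ∈ K
    · have h1 : b ≤ Φ.weight θ x := hb ⟨x, hx, rfl⟩
      linarith [neg_abs_le b]
    · have h1 : 0 ≤ Φ.weight θ x := hKw hx
      positivity
  have hθ' : 0 < 1 - θ := by linarith
  -- With this `C`, `∫ (weight + c)|φ|² dμ ≤ C‖w‖²`. Where the weight exceeds `C/ε`, `1 ≤
  -- (ε/C)(weight + c)`, which produces the factor `ε`.
  set C : ℝ := (1 - θ)⁻¹ + c with hC
  have hCpos : 0 < C := by positivity
  obtain ⟨K, hK, hKw⟩ := mem_cocompact.1 (hlim.eventually_ge_atTop (C / ε))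
  obtain ⟨R, hR0, hR⟩ := hK.isBounded.subset_closedBall_lt 0 0
  refine ⟨R, hR0, ?_⟩
  rintro w ⟨φ, hφ, hφc, hw, hdw⟩ χ hχm hχ0 hχ1 hχR
  have hsq : HasCompactSupport fun x => ‖φ x‖ ^ 2 := hφc.mono fun x hx h0 => hx (by simp [h0])
  have i1 : Integrable (fun x => Φ.weight θ x * ‖φ x‖ ^ 2) Φ.μ :=
    ((Φ.continuous_weight θ).mul (hφ.continuous.norm.pow 2)).integrable_of_hasCompactSupport
      hsq.mul_left
  have i2 : Integrable (fun x => ‖φ x‖ ^ 2) Φ.μ :=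
    (hφ.continuous.norm.pow 2).integrable_of_hasCompactSupport hsq
  have h1 : ∫ x, (Φ.weight θ x + c) * ‖φ x‖ ^ 2 ∂Φ.μ ≤ C * ‖w‖ ^ 2 := by
    simp only [add_mul]
    rw [integral_add i1 (i2.const_mul c), integral_const_mul, ← norm_sq_eq_integral hw]
    have h2 := integral_weight_le Φ hθ hφ hφc
    rw [← norm_sq_eq_integral hdw] at h2
    rw [H1.norm_sq_eq]
    have h3 : 0 < (1 - θ)⁻¹ := inv_pos.2 hθ'
    nlinarith [sq_nonneg ‖H1.embedding Φ w‖, sq_nonneg ‖H1.d Φ w‖]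
  have h4 : ∫ x, ‖χ x • (H1.embedding Φ w : E n → ℂ) x‖ ^ 2 ∂Φ.μ ≤
      ∫ x, ε / C * ((Φ.weight θ x + c) * ‖φ x‖ ^ 2) ∂Φ.μ := by
    refine integral_mono_of_nonneg (Eventually.of_forall fun x => by positivity) ?_ ?_
    · refine Integrable.const_mul ?_ _
      simp only [add_mul]
      exact i1.add (i2.const_mul c)
    · filter_upwards [hw] with x hx
      rw [hx, norm_smul, mul_pow, Real.norm_of_nonneg (hχ0 x), ← mul_assoc]
      refine mul_le_mul_of_nonneg_right ?_ (sq_nonneg _)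
      by_cases hxR : ‖x‖ ≤ R
      · rw [hχR x hxR]
        simpa using mul_nonneg (div_pos hε hCpos).le (hc x)
      · have hxK : x ∉ K := fun h => hxR (by simpa using hR h)
        have h5 : C / ε ≤ Φ.weight θ x := hKw hxK
        calc χ x ^ 2 ≤ 1 := pow_le_one₀ (hχ0 x) (hχ1 x)
          _ = ε / C * (C / ε) := by field_simp
          _ ≤ ε / C * (Φ.weight θ x + c) := by gcongr; linarith
  refine h4.trans ?_
  rw [integral_const_mul]
  calc _ ≤ ε / C * (C * ‖w‖ ^ 2) := by gcongr
    _ = ε * ‖w‖ ^ 2 := by field_simp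

/-! ### Averages over the cells of a grid -/

/-- The index of the cell of the grid `hℤⁿ` that contains `x`. -/
def gridIndex (h : ℝ) (x : E n) : Fin n → ℤ := fun i => ⌊x i / h⌋

/-- The half-open cubes of side `h` with corners in `hℤⁿ`. -/
def gridCell (h : ℝ) (k : Fin n → ℤ) : Set (E n) := {x | gridIndex h x = k}

theorem measurable_gridIndex (h : ℝ) : Measurable (gridIndex h : E n → Fin n → ℤ) :=
  measurable_pi_lambda _ fun i => Int.measurable_floor.comp
    ((EuclideanSpace.proj (𝕜 := ℝ) i).continuous.measurable.div_const h)

theorem measurableSet_gridCell (h : ℝ) (k : Fin n → ℤ) : MeasurableSet (gridCell h k) :=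
  measurable_gridIndex h (measurableSet_singleton k)

theorem volume_gridCell {h : ℝ} (hh : 0 < h) (k : Fin n → ℤ) :
    volume (gridCell h k) = ENNReal.ofReal h ^ n := by
  have he : gridCell h k = (WithLp.ofLp : E n → Fin n → ℝ) ⁻¹'
      Set.pi Set.univ fun i => Set.Ico ((k i : ℝ) * h) ((k i + 1 : ℝ) * h) := by
    ext x
    simp only [gridCell, gridIndex, Set.mem_ofPred_eq, Set.mem_preimage, Set.mem_pi, Set.mem_univ,
      forall_const, Set.mem_Ico, funext_iff, Int.floor_eq_iff, le_div_iff₀ hh, div_lt_iff₀ hh]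
  rw [he, (PiLp.volume_preserving_ofLp (Fin n)).measure_preimage
    (MeasurableSet.univ_pi fun i => measurableSet_Ico).nullMeasurableSet, Real.volume_pi_Ico]
  simp [add_mul]

/-- The open cube of side `2h` centred at the origin. -/
def centredCube (n : ℕ) (h : ℝ) : Set (E n) := {z | ∀ i, |z i| < h}

theorem centredCube_eq (h : ℝ) : centredCube n h = (WithLp.ofLp : E n → Fin n → ℝ) ⁻¹'
    Set.pi Set.univ fun _ => Set.Ioo (-h) h := by
  ext x
  simp [centredCube, abs_lt]

theorem measurableSet_centredCube (h : ℝ) : MeasurableSet (centredCube n h) := by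
  rw [centredCube_eq]
  exact (PiLp.volume_preserving_ofLp (Fin n)).measurable
    (MeasurableSet.univ_pi fun i => measurableSet_Ioo)

theorem volume_centredCube (h : ℝ) :
    volume (centredCube n h) = 2 ^ n * ENNReal.ofReal h ^ n := by
  rw [centredCube_eq, (PiLp.volume_preserving_ofLp (Fin n)).measure_preimage
    (MeasurableSet.univ_pi fun i => measurableSet_Ioo).nullMeasurableSet, Real.volume_pi_Ioo]
  have : h - -h = 2 * h := by ring
  simp [this, ENNReal.ofReal_mul, mul_pow]

theorem norm_le_of_mem_centredCube {h : ℝ} {z : E n} (hz : z ∈ centredCube n h) :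
    ‖z‖ ≤ Real.sqrt n * h := by
  rcases isEmpty_or_nonempty (Fin n) with hn | ⟨⟨i⟩⟩
  · have h0 : n = 0 := Nat.eq_zero_of_not_pos fun hp => hn.false ⟨0, hp⟩
    subst h0
    simp [EuclideanSpace.norm_eq]
  · have hh : 0 ≤ h := (abs_nonneg _).trans (hz i).le
    rw [EuclideanSpace.norm_eq, ← Real.sqrt_sq hh, ← Real.sqrt_mul (by positivity)]
    refine Real.sqrt_le_sqrt ?_
    calc ∑ i, ‖z i‖ ^ 2 ≤ ∑ _i : Fin n, h ^ 2 :=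
          Finset.sum_le_sum fun i _ => by
            rw [Real.norm_eq_abs]
            exact pow_le_pow_left₀ (abs_nonneg _) (hz i).le 2
      _ = n * h ^ 2 := by simp

theorem sub_mem_centredCube {h : ℝ} (hh : 0 < h) {x y : E n} (hxy : gridIndex h y = gridIndex h x) :
    y - x ∈ centredCube n h := by
  intro i
  have h1 : ⌊y i / h⌋ = ⌊x i / h⌋ := congrFun hxy i
  have h2 := Int.abs_sub_lt_one_of_floor_eq_floor h1
  rwa [← sub_div, abs_div, abs_of_pos hh, div_lt_one hh] at h2

theorem finite_gridIndex_image {h : ℝ} (hh : 0 < h) (R : ℝ) :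
    (gridIndex h '' Metric.closedBall (0 : E n) R).Finite := by
  refine (Set.finite_Icc (fun _ : Fin n => ⌊-R / h⌋) (fun _ => ⌊R / h⌋)).subset ?_
  rintro _ ⟨x, hx, rfl⟩
  have hx' : ∀ i, |x i| ≤ R := fun i => by
    have h1 : ‖x i‖ ≤ ‖x‖ := PiLp.norm_apply_le x i
    rw [Real.norm_eq_abs] at h1
    exact h1.trans (by simpa using hx)
  constructor
  · intro i
    refine Int.floor_le_floor ?_
    have := (abs_le.1 (hx' i)).1
    gcongr
  · intro i
    refine Int.floor_le_floor ?_
    have := (abs_le.1 (hx' i)).2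
    gcongr

/-- The averages of a `C¹` function over the cells of a grid of mesh `h` approximate it in `L²`. -/
theorem lintegral_sub_gridAverage_le {h : ℝ} (hh : 0 < h) {v : E n → ℂ} (hv : ContDiff ℝ 1 v)
    (hc : HasCompactSupport v) :
    ∫⁻ x, ‖v x - ∫ y in gridCell h (gridIndex h x), (h ^ n)⁻¹ • v y‖ₑ ^ 2 ≤
      2 ^ n * ENNReal.ofReal (Real.sqrt n * h) ^ 2 * ∫⁻ x, ‖fderiv ℝ v x‖ₑ ^ 2 := by
  set c : ℝ≥0∞ := ENNReal.ofReal h ^ n with hcdef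
  have hc0 : c ≠ 0 := pow_ne_zero _ (by simpa using hh)
  have hct : c ≠ ⊤ := ENNReal.pow_ne_top ENNReal.ofReal_ne_top
  have hpt : ∀ x, ‖v x - ∫ y in gridCell h (gridIndex h x), (h ^ n)⁻¹ • v y‖ₑ ^ 2 ≤
      ∫⁻ z in centredCube n h, c⁻¹ * ‖v (x + z) - v x‖ₑ ^ 2 := by
    intro x
    set Q := gridCell h (gridIndex h x) with hQ
    have hvol : volume Q = c := volume_gridCell hh _
    let ν : Measure (E n) := c⁻¹ • volume.restrict Q
    have hν : IsProbabilityMeasure ν := ⟨by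
      simp [ν, hvol, ENNReal.inv_mul_cancel hc0 hct]⟩
    have hmean : ∫ y in Q, (h ^ n)⁻¹ • v y = ∫ y, v y ∂ν := by
      rw [integral_smul, integral_smul_measure]
      congr 1
      rw [hcdef, ENNReal.toReal_inv, ENNReal.toReal_pow, ENNReal.toReal_ofReal hh.le]
    have hvi : Integrable v ν :=
      ((hv.continuous.integrable_of_hasCompactSupport hc).restrict).smul_measure
        (ENNReal.inv_ne_top.2 hc0)
    have h1 : v x - ∫ y in Q, (h ^ n)⁻¹ • v y = ∫ y, (v x - v y) ∂ν := by
      rw [hmean, integral_sub (integrable_const _) hvi]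
      simp
    have hm : Measurable fun y => ‖v x - v y‖ₑ :=
      (continuous_const.sub hv.continuous).enorm.measurable
    have hm' : Measurable fun y => ‖v y - v x‖ₑ ^ 2 :=
      ((hv.continuous.sub continuous_const).enorm.measurable).pow_const 2
    rw [h1]
    calc ‖∫ y, (v x - v y) ∂ν‖ₑ ^ 2 ≤ (∫⁻ y, ‖v x - v y‖ₑ ∂ν) ^ 2 := by
          gcongr; exact enorm_integral_le_lintegral_enorm _
      _ ≤ ∫⁻ y, ‖v x - v y‖ₑ ^ 2 ∂ν := sq_lintegral_le_lintegral_sq ν hm.aemeasurable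
      _ = c⁻¹ * ∫⁻ y in Q, ‖v y - v x‖ₑ ^ 2 := by
          rw [lintegral_smul_measure, smul_eq_mul]
          congr 1
          refine lintegral_congr fun y => ?_
          rw [← enorm_neg, neg_sub]
      -- In the variable `z = y - x` the cell is contained in a cube independent of `x`, so Tonelli
      -- and the translation estimate apply. The enlargement costs the volume ratio `2 ^ n`.
      _ = c⁻¹ * ∫⁻ z, (Q.indicator fun y => ‖v y - v x‖ₑ ^ 2) (x + z) := by
          rw [lintegral_add_left_eq_self (fun y => (Q.indicator fun y => ‖v y - v x‖ₑ ^ 2) y) x,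
            lintegral_indicator (measurableSet_gridCell h _)]
      _ ≤ c⁻¹ * ∫⁻ z in centredCube n h, ‖v (x + z) - v x‖ₑ ^ 2 := by
          rw [← lintegral_indicator (measurableSet_centredCube h)]
          gcongr with z
          by_cases hz : x + z ∈ Q
          · have hz' : z ∈ centredCube n h := by
              have := sub_mem_centredCube hh (x := x) (y := x + z) hz
              rwa [add_sub_cancel_left] at this
            rw [Set.indicator_of_mem hz', Set.indicator_of_mem hz]
          · rw [Set.indicator_of_notMem hz]
            exact bot_le
      _ = _ := by
          rw [lintegral_const_mul]
          exact ((hv.continuous.comp (continuous_const.add continuous_id)).sub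
            continuous_const).enorm.measurable.pow_const 2
  have hm : Measurable fun p : E n × E n => c⁻¹ * ‖v (p.1 + p.2) - v p.1‖ₑ ^ 2 :=
    (((hv.continuous.comp (continuous_fst.add continuous_snd)).sub
      (hv.continuous.comp continuous_fst)).enorm.measurable.pow_const 2).const_mul _
  calc ∫⁻ x, ‖v x - ∫ y in gridCell h (gridIndex h x), (h ^ n)⁻¹ • v y‖ₑ ^ 2
      ≤ ∫⁻ x, ∫⁻ z in centredCube n h, c⁻¹ * ‖v (x + z) - v x‖ₑ ^ 2 := lintegral_mono hpt
    _ = ∫⁻ z in centredCube n h, ∫⁻ x, c⁻¹ * ‖v (x + z) - v x‖ₑ ^ 2 :=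
        lintegral_lintegral_swap hm.aemeasurable
    _ ≤ ∫⁻ _ in centredCube n h, c⁻¹ * (ENNReal.ofReal (Real.sqrt n * h) ^ 2 *
          ∫⁻ x, ‖fderiv ℝ v x‖ₑ ^ 2) := by
        refine setLIntegral_mono measurable_const fun z hz => ?_
        rw [lintegral_const_mul]
        · gcongr
          refine (lintegral_translate_sub_le hv z).trans ?_
          gcongr
          rw [← ofReal_norm]
          exact ENNReal.ofReal_le_ofReal (norm_le_of_mem_centredCube hz)
        · exact ((hv.continuous.comp (continuous_id.add continuous_const)).sub
            hv.continuous).enorm.measurable.pow_const 2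
    _ = _ := by
        rw [setLIntegral_const, volume_centredCube, ← hcdef]
        calc _ = (c⁻¹ * c) * (2 ^ n * (ENNReal.ofReal (Real.sqrt n * h) ^ 2 *
              ∫⁻ x, ‖fderiv ℝ v x‖ₑ ^ 2)) := by ring
          _ = _ := by rw [ENNReal.inv_mul_cancel hc0 hct, one_mul, mul_assoc]

/-! ### Compactness of the embedding -/

theorem norm_fderiv_le_norm_formGrad (φ : E n → ℂ) (x : E n) :
    ‖fderiv ℝ φ x‖ ≤ ‖formGrad φ x‖ := by
  refine ContinuousLinearMap.opNorm_le_bound _ (norm_nonneg _) fun z => ?_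
  have hz : z = ∑ j, z j • EuclideanSpace.single j (1 : ℝ) := by
    simpa using ((EuclideanSpace.basisFun (Fin n) ℝ).sum_repr z).symm
  have h1 : fderiv ℝ φ x z = ∑ j, z j • fderiv ℝ φ x (EuclideanSpace.single j 1) := by
    conv_lhs => rw [hz]
    simp only [map_sum, map_smul]
  rw [h1, EuclideanSpace.norm_eq, EuclideanSpace.norm_eq]
  calc ‖∑ j, z j • fderiv ℝ φ x (EuclideanSpace.single j 1)‖
      ≤ ∑ j, ‖formGrad φ x j‖ * ‖z j‖ := by
        refine (norm_sum_le _ _).trans (Finset.sum_le_sum fun j _ => ?_)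
        rw [norm_smul, mul_comm]
        rfl
    _ ≤ _ := Real.sum_mul_le_sqrt_mul_sqrt _ _ _

/-- Localised functions in `H¹(μ)` are approximated by their grid averages, at a rate that is
uniform on bounded subsets of `H¹(μ)`. -/
theorem exists_local_approx (Φ : Potential n) {χ : E n → ℝ} (hχ : ContDiff ℝ ∞ χ)
    (hχc : HasCompactSupport χ) (hχ0 : ∀ x, 0 ≤ χ x) (hχ1 : ∀ x, χ x ≤ 1) {B : Set (E n)}
    (hB : IsCompact B) :
    ∃ D : ℝ≥0∞, D ≠ ⊤ ∧ ∀ h : ℝ, 0 < h → ∀ w : H1 Φ, ∀ φ : E n → ℂ, ContDiff ℝ ∞ φ →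
      (H1.embedding Φ w : E n → ℂ) =ᵐ[Φ.μ] φ →
      (H1.d Φ w : E n → EuclideanSpace ℂ (Fin n)) =ᵐ[Φ.μ] formGrad φ →
      eLpNorm (B.indicator fun x => χ x • φ x -
        ∫ y in gridCell h (gridIndex h x), (h ^ n)⁻¹ • χ y • φ y) 2 Φ.μ ≤
        ENNReal.ofReal h * D * ‖w‖ₑ := by
  obtain ⟨C₁, hC₁, hμ⟩ := Φ.exists_restrict_μ_le hB
  obtain ⟨C₂, hC₂, hvol⟩ := Φ.exists_restrict_volume_le (K := tsupport χ) hχc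
  obtain ⟨M, hM⟩ := (hχ.continuous_fderiv (by simp)).bounded_above_of_compact_support
    (hχc.fderiv (𝕜 := ℝ))
  have hM0 : 0 ≤ M := (norm_nonneg _).trans (hM 0)
  -- `C₁` passes from `μ` to Lebesgue measure on `B`, the middle factors come from the grid
  -- estimate, `C₂` returns to `μ` on the support of `χ`, and `1 + M` is the Leibniz rule for `χφ`.
  refine ⟨C₁ ^ (1 / 2 : ℝ) * ((2 ^ n : ℝ≥0∞) ^ (1 / 2 : ℝ) * ENNReal.ofReal (Real.sqrt n) *
    (C₂ ^ (1 / 2 : ℝ) * (1 + ENNReal.ofReal M))), ?_, ?_⟩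
  · have r : ∀ {a : ℝ≥0∞}, a ≠ ⊤ → a ^ (1 / 2 : ℝ) ≠ ⊤ := fun ha =>
      ENNReal.rpow_ne_top_of_nonneg (by norm_num) ha
    exact ENNReal.mul_ne_top (r hC₁) (ENNReal.mul_ne_top (ENNReal.mul_ne_top (r (by simp))
      ENNReal.ofReal_ne_top) (ENNReal.mul_ne_top (r hC₂) (by simp)))
  intro h hh w φ hφ hw hdw
  obtain ⟨v, hv⟩ : ∃ v : E n → ℂ, v = fun x => χ x • φ x := ⟨_, rfl⟩
  have hvs : ContDiff ℝ ∞ v := hv ▸ hχ.smul hφ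
  have hvc : HasCompactSupport v := hv ▸ hχc.smul_right
  have hJ : eLpNorm φ 2 Φ.μ ≤ ‖w‖ₑ := by
    rw [← eLpNorm_congr_ae hw, ← Lp.enorm_def, enorm_le_iff_norm_le]
    refine le_of_sq_le_sq ?_ (norm_nonneg _)
    rw [H1.norm_sq_eq]
    linarith [sq_nonneg ‖H1.d Φ w‖]
  have hd : eLpNorm (formGrad φ) 2 Φ.μ ≤ ‖w‖ₑ := by
    rw [← eLpNorm_congr_ae hdw, ← Lp.enorm_def, enorm_le_iff_norm_le]
    refine le_of_sq_le_sq ?_ (norm_nonneg _)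
    rw [H1.norm_sq_eq]
    linarith [sq_nonneg ‖H1.embedding Φ w‖]
  have hfd : ∀ x, ‖fderiv ℝ v x‖ ≤ ‖‖formGrad φ x‖ + M * ‖φ x‖‖ := by
    intro x
    have h1 := ((hχ.contDiffAt (x := x)).differentiableAt (by simp)).hasFDerivAt.smul
      ((hφ.contDiffAt (x := x)).differentiableAt (by simp)).hasFDerivAt
    have h2 : fderiv ℝ v x = χ x • fderiv ℝ φ x + (fderiv ℝ χ x).smulRight (φ x) := by
      rw [hv]; exact h1.fderiv
    rw [h2, Real.norm_of_nonneg (by positivity)]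
    refine (norm_add_le _ _).trans (add_le_add ?_ ?_)
    · rw [norm_smul, Real.norm_of_nonneg (hχ0 x)]
      exact (mul_le_of_le_one_left (norm_nonneg _) (hχ1 x)).trans (norm_fderiv_le_norm_formGrad φ x)
    · rw [ContinuousLinearMap.norm_smulRight_apply]
      exact mul_le_mul_of_nonneg_right (hM x) (norm_nonneg _)
  have hgrad : eLpNorm (fderiv ℝ v) 2 volume ≤
      C₂ ^ (1 / 2 : ℝ) * (1 + ENNReal.ofReal M) * ‖w‖ₑ := by
    have hs : Function.support (fderiv ℝ v) ⊆ tsupport χ := by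
      refine (support_fderiv_subset ℝ).trans (closure_mono ?_)
      intro x hx h0
      exact hx (by rw [hv]; simp [h0])
    refine (eLpNorm_le_of_restrict_le hvol hs).trans ?_
    rw [mul_assoc]
    gcongr
    calc eLpNorm (fderiv ℝ v) 2 Φ.μ
        ≤ eLpNorm ((fun x => ‖formGrad φ x‖) + fun x => M * ‖φ x‖) 2 Φ.μ :=
          eLpNorm_mono hfd
      _ ≤ eLpNorm (fun x => ‖formGrad φ x‖) 2 Φ.μ + eLpNorm (fun x => M * ‖φ x‖) 2 Φ.μ :=
          eLpNorm_add_le (continuous_formGrad hφ).norm.aestronglyMeasurable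
            (hφ.continuous.norm.const_mul M).aestronglyMeasurable (by norm_num)
      _ ≤ ‖w‖ₑ + ENNReal.ofReal M * ‖w‖ₑ := by
          gcongr
          · rwa [eLpNorm_norm]
          · refine (eLpNorm_le_mul_eLpNorm_of_ae_le_mul (g := φ) (c := M)
              (Eventually.of_forall fun x => ?_) 2).trans (by gcongr)
            rw [norm_mul, Real.norm_of_nonneg hM0, norm_norm]
      _ = _ := by ring
  have havg : eLpNorm (fun x => v x - ∫ y in gridCell h (gridIndex h x), (h ^ n)⁻¹ • v y) 2 volume ≤
      (2 ^ n : ℝ≥0∞) ^ (1 / 2 : ℝ) * ENNReal.ofReal (Real.sqrt n * h) *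
        eLpNorm (fderiv ℝ v) 2 volume := by
    refine (ENNReal.pow_le_pow_left_iff two_ne_zero).1 ?_
    rw [mul_pow, mul_pow, eLpNorm_two_sq, eLpNorm_two_sq, ← ENNReal.rpow_natCast (_ ^ _),
      ← ENNReal.rpow_mul]
    simpa using lintegral_sub_gridAverage_le hh (hvs.of_le (by simp)) hvc
  calc _ ≤ C₁ ^ (1 / 2 : ℝ) * eLpNorm (B.indicator fun x => v x -
        ∫ y in gridCell h (gridIndex h x), (h ^ n)⁻¹ • v y) 2 volume := by
        rw [hv]
        exact eLpNorm_le_of_restrict_le hμ Set.support_indicator_subset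
    _ ≤ C₁ ^ (1 / 2 : ℝ) * ((2 ^ n : ℝ≥0∞) ^ (1 / 2 : ℝ) * ENNReal.ofReal (Real.sqrt n * h) *
        (C₂ ^ (1 / 2 : ℝ) * (1 + ENNReal.ofReal M) * ‖w‖ₑ)) := by
        gcongr
        refine (eLpNorm_indicator_le _).trans (havg.trans ?_)
        gcongr
    _ = _ := by
        rw [ENNReal.ofReal_mul (Real.sqrt_nonneg _)]
        ring

theorem coeFn_finset_sum_Lp {ι α F : Type*} [MeasurableSpace α] {μ : Measure α}
    [NormedAddCommGroup F] (s : Finset ι) (f : ι → Lp F 2 μ) :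
    ((∑ k ∈ s, f k : Lp F 2 μ) : α → F) =ᵐ[μ] fun x => ∑ k ∈ s, (f k : α → F) x := by
  classical
  induction s using Finset.induction_on with
  | empty => simpa using! Lp.coeFn_zero F 2 μ
  | insert a s ha ih =>
    simp only [Finset.sum_insert ha]
    filter_upwards [Lp.coeFn_add (f a) (∑ k ∈ s, f k), ih] with x h1 h2
    rw [h1, Pi.add_apply, h2]

theorem isCompactOperator_smulRight {H H' : Type*} [NormedAddCommGroup H] [NormedSpace ℂ H]
    [NormedAddCommGroup H'] [NormedSpace ℂ H'] (F : H →L[ℂ] ℂ) (g : H') :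
    IsCompactOperator (F.smulRight g) := by
  have h1 : IsCompactOperator F := isCompactOperator_of_locallyCompactSpace_dom F
  exact h1.clm_comp (ContinuousLinearMap.toSpanSingleton ℂ g)

/-- The finite rank operator taking averages of `χu` over the cells of a grid. -/
theorem exists_gridOperator (Φ : Potential n) {χ : E n → ℝ} (hχ : Continuous χ)
    (hχc : HasCompactSupport χ) (R : ℝ) {h : ℝ} (hh : 0 < h) :
    ∃ K : L2 Φ →L[ℂ] L2 Φ, IsCompactOperator K ∧ ∀ (u : L2 Φ) (φ : E n → ℂ), u =ᵐ[Φ.μ] φ →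
      (K u : E n → ℂ) =ᵐ[Φ.μ] (Metric.closedBall (0 : E n) R).indicator fun x =>
        ∫ y in gridCell h (gridIndex h x), (h ^ n)⁻¹ • χ y • φ y := by
  have hF : ∀ k : Fin n → ℤ, ∃ F : L2 Φ →L[ℂ] ℂ, ∀ (u : L2 Φ) (φ : E n → ℂ), u =ᵐ[Φ.μ] φ →
      F u = ∫ y in gridCell h k, (h ^ n)⁻¹ • χ y • φ y := by
    intro k
    obtain ⟨F, hF⟩ := exists_functional Φ
      (ψ := (gridCell h k).indicator fun y => (h ^ n)⁻¹ * χ y) (by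
        refine (MemLp.indicator (measurableSet_gridCell h k)
          (memLp_mul_exp Φ (hχ.const_mul (h ^ n)⁻¹) hχc.mul_left)).ae_eq
          (Eventually.of_forall fun x => ?_)
        by_cases hx : x ∈ gridCell h k <;> simp [hx])
    refine ⟨F, fun u φ hu => ?_⟩
    rw [hF, ← integral_indicator (measurableSet_gridCell h k)]
    refine integral_congr_ae ?_
    filter_upwards [Φ.volume_ac.ae_eq hu] with x hx
    by_cases hxk : x ∈ gridCell h k <;> simp [hxk, hx, mul_assoc]
  choose F hF using hF
  set B := Metric.closedBall (0 : E n) R with hB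
  have hBm : MeasurableSet B := measurableSet_closedBall
  have hm : ∀ k, MeasurableSet (gridCell h k ∩ B) := fun k => (measurableSet_gridCell h k).inter hBm
  -- Only finitely many cells meet the ball, so the sum over `S` has finite rank.
  set S := (finite_gridIndex_image (n := n) hh R).toFinset with hS
  let g : (Fin n → ℤ) → L2 Φ := fun k => indicatorConstLp 2 (hm k) (measure_ne_top Φ.μ _) (1 : ℂ)
  refine ⟨∑ k ∈ S, (F k).smulRight (g k), ?_, fun u φ hu => ?_⟩
  · have : ∑ k ∈ S, (F k).smulRight (g k) ∈ compactOperator (RingHom.id ℂ) (L2 Φ) (L2 Φ) :=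
      Submodule.sum_mem _ fun k _ => isCompactOperator_smulRight (F k) (g k)
    exact this
  · have e1 : (∑ k ∈ S, (F k).smulRight (g k)) u = ∑ k ∈ S, F k u • g k := by
      simp
    rw [e1]
    have e2 : ∀ k, ((F k u • g k : L2 Φ) : E n → ℂ) =ᵐ[Φ.μ]
        fun x => F k u * (gridCell h k ∩ B).indicator (fun _ => 1) x := fun k => by
      filter_upwards [Lp.coeFn_smul (F k u) (g k), indicatorConstLp_coeFn (p := 2) (hs := hm k)
        (hμs := measure_ne_top Φ.μ _) (c := (1 : ℂ))] with x h1 h2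
      rw [h1, Pi.smul_apply, h2, smul_eq_mul]
    filter_upwards [coeFn_finset_sum_Lp S fun k => F k u • g k, ae_all_iff.2 e2] with x h1 h2
    rw [h1]
    simp only [h2]
    by_cases hx : x ∈ B
    · rw [Set.indicator_of_mem hx, Finset.sum_eq_single (gridIndex h x), hF _ u φ hu]
      · have : x ∈ gridCell h (gridIndex h x) ∩ B := ⟨rfl, hx⟩
        rw [Set.indicator_of_mem this, mul_one]
      · intro k _ hk
        have : x ∉ gridCell h k ∩ B := fun h' => hk h'.1.symm
        rw [Set.indicator_of_notMem this, mul_zero]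
      · intro hk
        exact absurd ((Set.Finite.mem_toFinset _).2 (Set.mem_image_of_mem _ hx)) hk
    · rw [Set.indicator_of_notMem hx]
      refine Finset.sum_eq_zero fun k _ => ?_
      have : x ∉ gridCell h k ∩ B := fun h' => hx h'.2
      rw [Set.indicator_of_notMem this, mul_zero]

/-- `u - v` splits into the tail `(1 - χ)φ` and the local error `χφ - a` on the ball; off the ball
both `χ` and `v` vanish. Each piece contributes `ηN/2`. -/
theorem norm_sub_le_of_split {Φ : Potential n} {η R : ℝ} (hη : 0 < η) {χ : E n → ℝ}
    (hχ : Continuous χ) (hχR : ∀ x, R ≤ ‖x‖ → χ x = 0) {u v : L2 Φ} {φ a : E n → ℂ} {b : ℝ≥0∞}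
    {N : ℝ} (hu : u =ᵐ[Φ.μ] φ)
    (hv : v =ᵐ[Φ.μ] (Metric.closedBall (0 : E n) R).indicator a)
    (hb : eLpNorm ((Metric.closedBall (0 : E n) R).indicator fun x => χ x • φ x - a x) 2 Φ.μ ≤ b)
    (hφ : Continuous φ) (hφc : HasCompactSupport φ)
    (ht : ∫ x, ‖(1 - χ x) • (u : E n → ℂ) x‖ ^ 2 ∂Φ.μ ≤ (η / 2) ^ 2 * N ^ 2) (hN : 0 ≤ N)
    (hbN : b ≤ ENNReal.ofReal (η / 2) * ENNReal.ofReal N) :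
    ‖u - v‖ ≤ η * N := by
  set B := Metric.closedBall (0 : E n) R with hB
  obtain ⟨A, hA⟩ : ∃ A : E n → ℂ, A = fun x => χ x • φ x - a x := ⟨_, rfl⟩
  obtain ⟨T, hT⟩ : ∃ T : E n → ℂ, T = fun x => (1 - χ x) • φ x := ⟨_, rfl⟩
  rw [← hA] at hb
  have hTc : Continuous T := by
    rw [hT]
    exact (continuous_const.sub hχ).smul hφ
  have hTs : HasCompactSupport T := hφc.mono fun x hx h0 => hx (by simp [hT, h0])
  have hTL : MemLp T 2 Φ.μ := hTc.memLp_of_hasCompactSupport hTs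
  have hsum : ((u - v : L2 Φ) : E n → ℂ) =ᵐ[Φ.μ] T + B.indicator A := by
    filter_upwards [Lp.coeFn_sub u v, hu, hv] with x h1 h2 h3
    rw [h1, Pi.sub_apply, h2, h3, Pi.add_apply]
    by_cases hx : x ∈ B
    · rw [Set.indicator_of_mem hx, Set.indicator_of_mem hx]
      simp only [hA, hT, sub_smul, one_smul]
      abel
    · rw [Set.indicator_of_notMem hx, Set.indicator_of_notMem hx]
      have : χ x = 0 := hχR x (by
        rw [hB, mem_closedBall_zero_iff, not_le] at hx
        exact hx.le)
      simp [hT, this]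
  have hT2 : ‖hTL.toLp T‖ ≤ η / 2 * N := by
    have h1 : ∫ x, ‖T x‖ ^ 2 ∂Φ.μ = ∫ x, ‖(1 - χ x) • (u : E n → ℂ) x‖ ^ 2 ∂Φ.μ := by
      rw [hT]
      exact integral_congr_ae (hu.mono fun x hx => by simp only [hx])
    rw [← h1, ← norm_sq_eq_integral hTL.coeFn_toLp, ← mul_pow] at ht
    exact (sq_le_sq₀ (norm_nonneg _) (by positivity)).1 ht
  have hT3 : eLpNorm T 2 Φ.μ ≤ ENNReal.ofReal (η / 2 * N) := by
    rw [← Lp.enorm_toLp hTL, ← ofReal_norm]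
    exact ENNReal.ofReal_le_ofReal hT2
  -- Nothing is assumed about measurability of `a`; it is recovered from `u - v` by subtracting `T`.
  have hAm : AEStronglyMeasurable (B.indicator A) Φ.μ := by
    have h2 := ((Lp.aestronglyMeasurable (u - v)).congr hsum).sub hTL.1
    rwa [add_sub_cancel_left] at h2
  rw [← ENNReal.ofReal_le_ofReal_iff (by positivity), ofReal_norm, Lp.enorm_def,
    eLpNorm_congr_ae hsum]
  calc eLpNorm (T + B.indicator A) 2 Φ.μ
      ≤ eLpNorm T 2 Φ.μ + eLpNorm (B.indicator A) 2 Φ.μ := eLpNorm_add_le hTL.1 hAm (by norm_num)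
    _ ≤ ENNReal.ofReal (η / 2 * N) + ENNReal.ofReal (η / 2 * N) := by
        rw [← ENNReal.ofReal_mul (by positivity)] at hbN
        exact add_le_add hT3 (hb.trans hbN)
    _ = ENNReal.ofReal (η * N) := by
        rw [← ENNReal.ofReal_add (by positivity) (by positivity)]
        congr 1
        ring

/-- The radius is chosen for the tail estimate first, and the mesh afterwards, since the local
constant `D` depends on the cutoff. Each error takes half of `η`. -/
theorem exists_compact_approx (Φ : Potential n) {θ : ℝ} (hθ : θ < 1)
    (hlim : Tendsto (Φ.weight θ) (cocompact (E n)) atTop) {η : ℝ} (hη : 0 < η) :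
    ∃ K : L2 Φ →L[ℂ] L2 Φ, IsCompactOperator K ∧
      ∀ w ∈ H1.test Φ, ‖H1.embedding Φ w - K (H1.embedding Φ w)‖ ≤ η * ‖w‖ := by
  obtain ⟨R, hR, htail⟩ := exists_tail_le Φ hθ hlim (ε := (η / 2) ^ 2) (by positivity)
  obtain ⟨χ, hχ, hχc, hχ0, hχ1, hχR, hχR'⟩ : ∃ χ : E n → ℝ, ContDiff ℝ ∞ χ ∧
      HasCompactSupport χ ∧ (∀ x, 0 ≤ χ x) ∧ (∀ x, χ x ≤ 1) ∧ (∀ x, ‖x‖ ≤ R → χ x = 1) ∧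
      ∀ x, R + 1 ≤ ‖x‖ → χ x = 0 := by
    let χ : ContDiffBump (0 : E n) := ⟨R, R + 1, hR, by linarith⟩
    exact ⟨χ, χ.contDiff, χ.hasCompactSupport, fun _ => χ.nonneg, fun _ => χ.le_one,
      fun x hx => χ.one_of_mem_closedBall (by simpa using hx),
      fun x hx => χ.zero_of_le_dist (by simpa using hx)⟩
  obtain ⟨D, hD, hloc⟩ := exists_local_approx Φ hχ hχc hχ0 hχ1
    (isCompact_closedBall (0 : E n) (R + 1))
  obtain ⟨h, hh, hhD⟩ : ∃ h : ℝ, 0 < h ∧ ENNReal.ofReal h * D ≤ ENNReal.ofReal (η / 2) := by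
    have h0 : 0 ≤ D.toReal := ENNReal.toReal_nonneg
    -- The `+ 1` keeps the denominator positive when `D = 0`.
    refine ⟨η / 2 / (D.toReal + 1), by positivity, ?_⟩
    obtain ⟨d, hd⟩ : ∃ d : ℝ, d = D.toReal := ⟨_, rfl⟩
    rw [← hd] at h0 ⊢
    rw [← ENNReal.ofReal_toReal hD, ← hd, ← ENNReal.ofReal_mul (by positivity)]
    refine ENNReal.ofReal_le_ofReal ?_
    rw [div_mul_eq_mul_div, div_le_iff₀ (by positivity)]
    nlinarith
  obtain ⟨K, hK, hKu⟩ := exists_gridOperator Φ hχ.continuous hχc (R + 1) hh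
  refine ⟨K, hK, fun w hw => ?_⟩
  have hw' := hw
  obtain ⟨φ, hφ, hφc, hJ, hd⟩ := hw'
  have hAB := hloc h hh w φ hφ hJ hd
  have hKw := hKu (H1.embedding Φ w) φ hJ
  obtain ⟨a, ha⟩ : ∃ a : E n → ℂ, a = fun x =>
    ∫ y in gridCell h (gridIndex h x), (h ^ n)⁻¹ • χ y • φ y := ⟨_, rfl⟩
  have ha' : ∀ x, ∫ y in gridCell h (gridIndex h x), (h ^ n)⁻¹ • χ y • φ y = a x :=
    fun x => by rw [ha]
  simp only [ha'] at hAB hKw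
  exact norm_sub_le_of_split hη hχ.continuous hχR' hJ hKw hAB (hφ.continuous) hφc
    (htail w hw (fun x => 1 - χ x) (continuous_const.sub hχ.continuous).measurable
      (fun x => sub_nonneg.2 (hχ1 x)) (fun x => sub_le_self _ (hχ0 x))
      fun x hx => by rw [hχR x hx, sub_self])
    (norm_nonneg _) (by rw [ofReal_norm]; exact mul_le_mul_left hhD ‖w‖ₑ)

/-- If `θ|Φ'|² - ΔΦ → ∞` for some `θ < 1`, then `H¹(μ)` is compactly embedded in `L²(μ)`. -/
theorem isCompactOperator_embedding (Φ : Potential n) {θ : ℝ} (hθ : θ < 1)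
    (hlim : Tendsto (Φ.weight θ) (cocompact (E n)) atTop) :
    IsCompactOperator (H1.embedding Φ) := by
  choose K hK hKw using fun k : ℕ =>
    exists_compact_approx Φ hθ hlim (η := 1 / ((k : ℝ) + 1)) (by positivity)
  refine isCompactOperator_of_tendsto (l := atTop)
    (F := fun k => (K k).comp (H1.embedding Φ)) ?_
    (Eventually.of_forall fun k => (hK k).comp_clm _)
  refine (tendsto_iff_norm_sub_tendsto_zero (E := H1 Φ →L[ℂ] L2 Φ)).2 ?_
  refine squeeze_zero (fun _ => ContinuousLinearMap.opNorm_nonneg _) (fun k => ?_)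
    tendsto_one_div_add_atTop_nhds_zero_nat
  refine ContinuousLinearMap.opNorm_le_bound _ (by positivity) fun w => ?_
  -- The bound is known on test functions; being a closed condition, it extends to `H¹(μ)` by
  -- density and becomes an operator norm estimate.
  have hclosed : IsClosed {w : H1 Φ | ‖((K k).comp (H1.embedding Φ) - H1.embedding Φ) w‖ ≤
      1 / ((k : ℝ) + 1) * ‖w‖} := isClosed_le (by fun_prop) (by fun_prop)
  refine hclosed.closure_subset_iff.2 (fun v hv => ?_) (H1.dense_test Φ w)
  have h := hKw k v hv
  rw [norm_sub_rev] at h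
  exact h

end WittenLaplacian

end

theorem proposition5p2 (n : ℕ) (Φ : WittenLaplacian.Potential n)
    (hΦ : ∃ θ : ℝ, 0 < θ ∧ θ < 1 ∧
      Tendsto (fun x => θ * ‖gradient Φ x‖ ^ 2 - Laplacian.laplacian (⇑Φ) x)
        (cocompact (WittenLaplacian.E n)) atTop) :
    IsCompactOperator (WittenLaplacian.H1.embedding Φ) ∧
      UnboundedOperator.essentialSpectrum (WittenLaplacian.A₀ Φ) = ∅ := by
  obtain ⟨θ, -, hθ, hlim⟩ := hΦ
  have h := WittenLaplacian.isCompactOperator_embedding Φ hθ hlim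
  exact ⟨h, WittenLaplacian.essentialSpectrum_A₀_eq_empty Φ h⟩
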